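/- Let $G$ be a countable discrete group and let $X$ be a second-countable, locally compact flow space for $G$, i.e. a second-countable, locally compact metric space with a continuous action of $G\times\mathbb{R}$ such that $G$ acts isometrically and properly (for every compact $K\subseteq X$ the set $\{g\in G\mid K\cap gK\neq\emptyset\}$ is finite). Write $\Phi_t x$ for the action of $t\in\mathbb{R}$ on $x \in X$, and assume that the small inductive dimension $\operatorname{ind}(X)$ is finite. The $G$-period of $x\in X$ is the infimum of all $t>0$ with $\Phi_t x\in Gx$ (and $\infty$ if there is no such $t$); for $\gamma\in\mathbb{R}$ let $X_{>\gamma}$ be the set of all $x\in X$ whose $G$-period is greater than $\gamma$. Then for every $\alpha>0$ there is a collection $\mathcal{U}$ of open subsets of $X$ such that: 1. $\mathcal{U}$ is a $\mathcal{F}in$-cover of $X_{>20\alpha}$: the union of $\mathcal{U}$ equals $X_{>20\alpha}$; for all $U\in\mathcal{U}$ and $g\in G$ we have $gU\in\mathcal{U}$, and $gU\cap U\neq\emptyset$ implies $gU=U$; and for every $U\in\mathcal{U}$ the group $\{g\in G\mid gU=U\}$ is finite; 2. $\mathcal{U}$ has dimension at most $5(\operatorname{ind}(X)+1)$, i.e.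 every point lies in at most $5(\operatorname{ind}(X)+1)+1$ members of $\mathcal{U}$; 3. for every $x\in X_{>20\alpha}$ there is a $U\in\mathcal{U}$ with $\Phi_{[-\alpha,\alpha]}(x)=\{\Phi_t x\mid -\alpha\le t\le\alpha\}\subseteq U$. -/

import Mathlib

open scoped Pointwise

namespace LongThin

variable {G X : Type*} [Group G] [MetricSpace X] [MulAction G X]

/-- A metric space `X` with a `G`-action and a (jointly continuous) flow `Φ` is a flow space for the
discrete group `G` if the two actions commute, so that together they form an action of `G × ℝ`
(jointly continuous because `G` is discrete and acts by isometries), and if `G` acts isometrically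
and properly. -/
structure IsFlowSpace (G : Type*) {X : Type*} [Group G] [MetricSpace X] [MulAction G X]
    (Φ : Flow ℝ X) : Prop where
  comm : ∀ (g : G) (t : ℝ) (x : X), Φ t (g • x) = g • Φ t x
  isometry : ∀ g : G, Isometry (fun x : X => g • x)
  proper : ∀ K : Set X, IsCompact K → {g : G | (K ∩ g • K).Nonempty}.Finite

/-- The class of `x` in the orbit space `G \ X`. -/
def orbitMk (G : Type*) {X : Type*} [Group G] [MulAction G X] (x : X) :
    MulAction.orbitRel.Quotient G X :=
  Quotient.mk (MulAction.orbitRel G X) x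

/-- The `G`-period of `x`: the period of `Gx` under the induced flow `t • Gx = G(Φ_t x)` on `G \ X`,
that is, the infimum of all `t > 0` with `G(Φ_t x) = Gx`, and `∞` if there is no such `t`. -/
noncomputable def gPeriod (G : Type*) {X : Type*} [Group G] [MetricSpace X] [MulAction G X]
    (Φ : Flow ℝ X) (x : X) : EReal :=
  sInf {s : EReal | ∃ t : ℝ, 0 < t ∧ orbitMk G (Φ t x) = orbitMk G x ∧ s = (t : EReal)}

/-- `X_{≤γ}`: the points of `G`-period at most `γ`. -/
def shortPart (G : Type*) {X : Type*} [Group G] [MetricSpace X] [MulAction G X]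
    (Φ : Flow ℝ X) (γ : ℝ) : Set X :=
  {x | gPeriod G Φ x ≤ (γ : EReal)}

/-- `X_{>γ}`: the complement of `X_{≤γ}`. -/
def longPart (G : Type*) {X : Type*} [Group G] [MetricSpace X] [MulAction G X]
    (Φ : Flow ℝ X) (γ : ℝ) : Set X :=
  (shortPart G Φ γ)ᶜ

/-- The family of all finite subgroups of `G`. -/
def finFamily (G : Type*) [Group G] : Set (Subgroup G) :=
  {H | Finite H}

/-- `U` is an `𝓕`-subset: its translates are equal to it or disjoint from it, and its setwise
stabilizer belongs to `𝓕`. -/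
def IsFamilySubset (𝓕 : Set (Subgroup G)) (U : Set X) : Prop :=
  (∀ g : G, (g • U ∩ U).Nonempty → g • U = U) ∧ MulAction.stabilizer G U ∈ 𝓕

/-- `𝒰` is an `𝓕`-collection: a `G`-invariant collection of `𝓕`-subsets. -/
def IsFamilyCollection (𝓕 : Set (Subgroup G)) (𝒰 : Set (Set X)) : Prop :=
  (∀ g : G, ∀ U ∈ 𝒰, g • U ∈ 𝒰) ∧ ∀ U ∈ 𝒰, IsFamilySubset 𝓕 U

/-- `𝒰` is an `𝓕`-cover of the `G`-invariant subspace `Y` of `X`: an `𝓕`-collection of subsets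
of `Y` whose union is `Y`. -/
def IsFamilyCoverOf (𝓕 : Set (Subgroup G)) (𝒰 : Set (Set X)) (Y : Set X) : Prop :=
  IsFamilyCollection 𝓕 𝒰 ∧ ⋃₀ 𝒰 = Y

/-- `𝒰` has dimension at most `d`: no point lies in more than `d + 1` members. -/
def HasCoverDimLE {X : Type*} (𝒰 : Set (Set X)) (d : ℕ) : Prop :=
  ∀ x : X, {U ∈ 𝒰 | x ∈ U}.encard ≤ (d : ℕ∞) + 1

end LongThin

namespace LongThin

open Set Topology TopologicalSpace

/-! The problem descends to the orbit space `M = G \ X`, a locally compact, second-countable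
metrizable space with an induced flow, where long `G`-period means absence of short periods.
Countably many compact sets that embed in `X` cover `M`, so its dimension is controlled piecewise
(`exists_compact_cover_orbit`).

Near a point without short period there is a compact transversal slice (`exists_isSlice`). If `ind X
≤ n`, countably many slices are covered by `n + 1` flow-invariant sets `Z k`, each zero-dimensional
on every slice (`exists_invariant_decomposition`). Zero-dimensionality lets markers be chosen
greedily for each `k`, with no boundary in `Z k`: distinct markers are more than `2α` apart in time,
yet every core point of `Z k` is within `3α` of one (`exists_markers`). Flowing the markers for
times in `(-5α, 5α)` gives open boxes. An orbit meets at most `10α / 2α = 5` of the boxes of one `k`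
at a given point, hence at most `5(n + 1)` in all (`encard_boxes_le`), and long segments fit because
`5α = 3α + α + α`.

Each box is small enough to lie in the image of a `Fin`-subset around a flow segment, so the cover
lifts to `X` (`exists_isFamilyCoverOf_of_orbit`). -/

/-! ### Dimension theory: subspaces, dimension zero, countable closed sums. -/

theorem hasSmallInductiveDimensionLT_of_isInducing.{u} {n : ℕ} {A B : Type u}
    [TopologicalSpace A] [TopologicalSpace B] {f : A → B} (hf : IsInducing f)
    (h : HasSmallInductiveDimensionLT B n) : HasSmallInductiveDimensionLT A n := by
  induction n generalizing A B with
  | zero =>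
    rw [hasSmallInductiveDimensionLT_zero_iff] at h ⊢
    exact Function.isEmpty f
  | succ n ih =>
    cases h with
    | succ _ s hs h =>
      refine .succ n _ (hs.isInducing hf) ?_
      rintro _ ⟨U, hU, rfl⟩
      have hsub : MapsTo f (frontier (f ⁻¹' U)) (frontier U) :=
        fun x hx ↦ hf.continuous.frontier_preimage_subset U hx
      exact ih (f := hsub.restrict f _ _)
        (IsInducing.subtypeVal.of_comp_iff.1 (hf.comp IsInducing.subtypeVal)) (h U hU)

/-- Disjoint closed subsets of `Z` can be separated by a clopen set. -/
def ClopenSeparated (Z : Type*) [TopologicalSpace Z] : Prop :=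
  ∀ A B : Set Z, IsClosed A → IsClosed B → Disjoint A B → ∃ P, IsClopen P ∧ A ⊆ P ∧ Disjoint P B

/-- Countably many clopen sets, each missing `A` or `B`, cover the space. Made disjoint, they form a
clopen partition, and the pieces coming from sets that miss `B` make up `P`. -/
theorem clopenSeparated_of_isTopologicalBasis {Z : Type*} [TopologicalSpace Z] [LindelofSpace Z]
    {s : Set (Set Z)} (hs : IsTopologicalBasis s) (hc : ∀ U ∈ s, IsClopen U) :
    ClopenSeparated Z := by
  intro A B hA hB hAB
  have hex : ∀ x : Z, ∃ O, IsClopen O ∧ x ∈ O ∧ (Disjoint O A ∨ Disjoint O B) := by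
    intro x
    by_cases hx : x ∈ A
    · obtain ⟨O, hO, hxO, hOB⟩ :=
        hs.exists_subset_of_mem_open (hAB.notMem_of_mem_left hx : x ∈ Bᶜ) hB.isOpen_compl
      exact ⟨O, hc O hO, hxO, .inr (subset_compl_iff_disjoint_right.1 hOB)⟩
    · obtain ⟨O, hO, hxO, hOA⟩ := hs.exists_subset_of_mem_open (hx : x ∈ Aᶜ) hA.isOpen_compl
      exact ⟨O, hc O hO, hxO, .inl (subset_compl_iff_disjoint_right.1 hOA)⟩
  choose O hO hxO hdisj using hex
  obtain ⟨t, htc, ht⟩ := _root_.countable_cover_nhds fun x ↦ (hO x).isOpen.mem_nhds (hxO x)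
  rcases isEmpty_or_nonempty Z with hZ | hZ
  · exact ⟨∅, isClopen_empty, fun x ↦ (hZ.false x).elim, by simp⟩
  have htne : t.Nonempty := by
    obtain ⟨x⟩ := hZ
    have : x ∈ ⋃ y ∈ t, O y := ht ▸ mem_univ x
    simp only [mem_iUnion] at this
    exact ⟨_, this.choose_spec.choose⟩
  obtain ⟨u, rfl⟩ := htc.exists_eq_range htne
  have hcov : ⋃ k, O (u k) = univ := by simpa using ht
  have hD : ∀ k, IsClopen (disjointed (fun k ↦ O (u k)) k) := fun k ↦
    disjointedRec (p := IsClopen) (fun _ i hi ↦ hi.diff (hO (u i))) (hO (u k))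
  have hDcov : ⋃ k, disjointed (fun k ↦ O (u k)) k = univ := (iUnion_disjointed).trans hcov
  refine ⟨⋃ k ∈ {k | Disjoint (O (u k)) B}, disjointed (fun k ↦ O (u k)) k, ⟨?_, ?_⟩, ?_, ?_⟩
  · have : (⋃ k ∈ {k | Disjoint (O (u k)) B}, disjointed (fun k ↦ O (u k)) k)ᶜ =
        ⋃ k ∈ {k | ¬ Disjoint (O (u k)) B}, disjointed (fun k ↦ O (u k)) k := by
      ext x
      obtain ⟨k, hk⟩ := mem_iUnion.1 (hDcov.symm ▸ mem_univ x)
      have huniq : ∀ j, x ∈ disjointed (fun k ↦ O (u k)) j → j = k := fun j hj ↦ by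
        by_contra hne
        exact (disjoint_disjointed _ hne).notMem_of_mem_left hj hk
      simp only [mem_compl_iff, mem_iUnion, mem_ofPred_eq, exists_prop, not_exists, not_and]
      exact ⟨fun h ↦ ⟨k, fun hd ↦ h k hd hk, hk⟩,
        fun ⟨j, hj, hxj⟩ i hi hxi ↦ hj (by rwa [huniq j hxj, ← huniq i hxi])⟩
    rw [← isOpen_compl_iff, this]
    exact isOpen_biUnion fun k _ ↦ (hD k).isOpen
  · exact isOpen_biUnion fun k _ ↦ (hD k).isOpen
  · intro x hx
    obtain ⟨k, hk⟩ := mem_iUnion.1 (hDcov.symm ▸ mem_univ x)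
    refine mem_biUnion ?_ hk
    exact (hdisj (u k)).resolve_left fun h ↦ h.notMem_of_mem_left (disjointed_subset _ k hk) hx
  · simp only [disjoint_iUnion_left]
    exact fun k hk ↦ hk.mono_left (disjointed_subset _ k)

/-- The countable sum theorem in dimension zero. A disjoint closed pair is enlarged repeatedly; step
`k` distributes `C k` between the two sides, and normality keeps the sides disjoint while each
contains its predecessor in its interior. In the limit both sides are open and fill the space. -/
theorem clopenSeparated_of_iUnion_isClosed {Z : Type*} [TopologicalSpace Z] [NormalSpace Z]
    {C : ℕ → Set Z} (hC : ∀ k, IsClosed (C k)) (hcov : ⋃ k, C k = univ)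
    (h : ∀ k, ClopenSeparated (C k)) : ClopenSeparated Z := by
  intro A B hA hB hAB
  let T := {p : Set Z × Set Z // IsClosed p.1 ∧ IsClosed p.2 ∧ Disjoint p.1 p.2}
  have hstep : ∀ (k : ℕ) (p : T), ∃ q : T, p.1.1 ⊆ interior q.1.1 ∧ p.1.2 ⊆ interior q.1.2 ∧
      C k ⊆ q.1.1 ∪ q.1.2 := by
    rintro k ⟨⟨E, F⟩, hE, hF, hEF⟩
    obtain ⟨P, hP, hEP, hPF⟩ := h k (Subtype.val ⁻¹' E) (Subtype.val ⁻¹' F)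
      (hE.preimage continuous_subtype_val) (hF.preimage continuous_subtype_val)
      (hEF.preimage _)
    have hP1 : IsClosed (Subtype.val '' P) := (hC k).isClosedMap_subtype_val _ hP.isClosed
    have hP2 : IsClosed (Subtype.val '' Pᶜ) := (hC k).isClosedMap_subtype_val _ hP.compl.isClosed
    have hd : Disjoint (E ∪ Subtype.val '' P) (F ∪ Subtype.val '' Pᶜ) := by
      rw [disjoint_left]
      rintro x (hx | ⟨x, hx, rfl⟩) (hx' | ⟨y, hy, hyx⟩)
      · exact hEF.notMem_of_mem_left hx hx'
      · exact hy (hEP (by simpa [← hyx] using hx))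
      · exact hPF.notMem_of_mem_left hx hx'
      · exact hy (Subtype.ext hyx ▸ hx)
    obtain ⟨U, V, hU, hV, hEU, hFV, hUV⟩ := normal_separation (hE.union hP1) (hF.union hP2) hd
    obtain ⟨U', hU', hEU', hUU'⟩ := normal_exists_closure_subset (hE.union hP1) hU hEU
    obtain ⟨V', hV', hFV', hVV'⟩ := normal_exists_closure_subset (hF.union hP2) hV hFV
    refine ⟨⟨(closure U', closure V'), isClosed_closure, isClosed_closure,
      hUV.mono hUU' hVV'⟩, ?_, ?_, ?_⟩
    · exact subset_union_left.trans (hEU'.trans (interior_maximal subset_closure hU'))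
    · exact subset_union_left.trans (hFV'.trans (interior_maximal subset_closure hV'))
    · intro x hx
      by_cases hxP : (⟨x, hx⟩ : C k) ∈ P
      · exact .inl (subset_closure (hEU' (.inr ⟨_, hxP, rfl⟩)))
      · exact .inr (subset_closure (hFV' (.inr ⟨_, hxP, rfl⟩)))
  choose next h1 h2 h3 using hstep
  let p : ℕ → T := fun k ↦ Nat.rec ⟨(A, B), hA, hB, hAB⟩ next k
  have hm1 : Monotone fun k ↦ (p k).1.1 :=
    monotone_nat_of_le_succ fun k ↦ (h1 k (p k)).trans interior_subset
  have hm2 : Monotone fun k ↦ (p k).1.2 :=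
    monotone_nat_of_le_succ fun k ↦ (h2 k (p k)).trans interior_subset
  have ho1 : IsOpen (⋃ k, (p k).1.1) := by
    have : ⋃ k, (p k).1.1 = ⋃ k, interior (p k).1.1 :=
      Subset.antisymm (iUnion_subset fun k ↦ (h1 k (p k)).trans
        (subset_iUnion (fun k ↦ interior (p k).1.1) (k + 1)))
        (iUnion_mono fun k ↦ interior_subset)
    rw [this]
    exact isOpen_iUnion fun k ↦ isOpen_interior
  have ho2 : IsOpen (⋃ k, (p k).1.2) := by
    have : ⋃ k, (p k).1.2 = ⋃ k, interior (p k).1.2 :=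
      Subset.antisymm (iUnion_subset fun k ↦ (h2 k (p k)).trans
        (subset_iUnion (fun k ↦ interior (p k).1.2) (k + 1)))
        (iUnion_mono fun k ↦ interior_subset)
    rw [this]
    exact isOpen_iUnion fun k ↦ isOpen_interior
  have hd : Disjoint (⋃ k, (p k).1.1) (⋃ k, (p k).1.2) := by
    rw [disjoint_left]
    intro x hx hx'
    obtain ⟨i, hi⟩ := mem_iUnion.1 hx
    obtain ⟨j, hj⟩ := mem_iUnion.1 hx'
    exact (p (max i j)).2.2.2.notMem_of_mem_left (hm1 (le_max_left i j) hi)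
      (hm2 (le_max_right i j) hj)
  have hu : (⋃ k, (p k).1.1)ᶜ = ⋃ k, (p k).1.2 := by
    refine Subset.antisymm (fun x hx ↦ ?_) (subset_compl_iff_disjoint_left.2 hd)
    obtain ⟨k, hk⟩ := mem_iUnion.1 (hcov.symm ▸ mem_univ x)
    rcases h3 k (p k) hk with hk | hk
    · exact (hx (mem_iUnion.2 ⟨k + 1, hk⟩)).elim
    · exact mem_iUnion.2 ⟨k + 1, hk⟩
  refine ⟨⋃ k, (p k).1.1, ⟨?_, ho1⟩, ?_, ?_⟩
  · rwa [← isOpen_compl_iff, hu]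
  · exact subset_iUnion (fun k ↦ (p k).1.1) 0
  · exact hd.mono_right (subset_iUnion (fun k ↦ (p k).1.2) 0)

theorem clopenSeparated_of_isEmpty {Z : Type*} [TopologicalSpace Z] [IsEmpty Z] :
    ClopenSeparated Z :=
  fun _ _ _ _ _ ↦ ⟨∅, isClopen_empty, fun x ↦ isEmptyElim x, by simp⟩

theorem clopenSeparated_of_countable_iUnion {Z ι : Type*} [TopologicalSpace Z] [NormalSpace Z]
    [Countable ι] {C : ι → Set Z} (hC : ∀ k, IsClosed (C k)) (hcov : ⋃ k, C k = univ)
    (h : ∀ k, ClopenSeparated (C k)) : ClopenSeparated Z := by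
  rcases isEmpty_or_nonempty ι with hι | hι
  · have : IsEmpty Z := univ_eq_empty_iff.1 (by rw [← hcov, iUnion_of_empty])
    exact clopenSeparated_of_isEmpty
  · obtain ⟨u, hu⟩ := exists_surjective_nat ι
    exact clopenSeparated_of_iUnion_isClosed (C := fun k ↦ C (u k)) (fun k ↦ hC _)
      ((hu.iUnion_comp C).trans hcov) fun k ↦ h _

theorem hasSmallInductiveDimensionLT_of_bijective.{u} {n : ℕ} {E A : Type u} [TopologicalSpace E]
    [TopologicalSpace A] [CompactSpace E] [T2Space A] {f : E → A} (hf : Continuous f)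
    (hb : f.Bijective) (h : HasSmallInductiveDimensionLT E n) :
    HasSmallInductiveDimensionLT A n :=
  hasSmallInductiveDimensionLT_of_isInducing
    (Continuous.homeoOfEquivCompactToT2 (f := Equiv.ofBijective f hb) hf).symm.isInducing h

theorem hasSmallInductiveDimensionLT_of_injective.{u} {n : ℕ} {E A : Type u} [TopologicalSpace E]
    [TopologicalSpace A] [CompactSpace E] [T2Space A] {f : E → A} (hf : Continuous f)
    (hi : f.Injective) (h : HasSmallInductiveDimensionLT A n) :
    HasSmallInductiveDimensionLT E n :=
  hasSmallInductiveDimensionLT_of_isInducing (hf.isClosedEmbedding hi).isInducing h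

/-! ### Local slices of a flow. -/

section Slice

variable {M : Type*} [TopologicalSpace M] (Φ : Flow ℝ M)

theorem continuous_flow : Continuous fun p : ℝ × M ↦ Φ p.1 p.2 := Φ.cont'

theorem flow_neg_apply (t : ℝ) (x : M) : Φ (-t) (Φ t x) = x := by
  rw [← Flow.map_add, neg_add_cancel, Flow.map_zero_apply]

theorem injOn_flow_time {ℓ a b : ℝ} {S : Set M} (hab : b - a ≤ ℓ)
    (hS : ∀ y ∈ S, ∀ t, 0 < t → t ≤ ℓ → Φ t y ∉ S) {c : M} {s t : ℝ} (hs : s ∈ Icc a b)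
    (ht : t ∈ Icc a b) (hsc : Φ s c ∈ S) (htc : Φ t c ∈ S) : s = t := by
  have key : ∀ s ∈ Icc a b, ∀ t ∈ Icc a b, Φ s c ∈ S → Φ t c ∈ S → ¬ s < t := by
    intro s hs t ht hsc htc hst
    refine hS _ hsc (t - s) (sub_pos.2 hst) (by linarith [hs.1, ht.2]) ?_
    rwa [← Flow.map_add, sub_add_cancel]
  exact le_antisymm (not_lt.1 (key t ht s hs htc hsc)) (not_lt.1 (key s hs t ht hsc htc))

theorem isCompact_image2_flow {I : Set ℝ} {A : Set M} (hI : IsCompact I) (hA : IsCompact A) :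
    IsCompact (image2 Φ I A) := by
  rw [← image_prod]
  exact (hI.prod hA).image (continuous_flow Φ)

variable [MetrizableSpace M]

/-- Near a point that does not return at time `ℓ`, some continuous function increases strictly
along the flow. -/
theorem exists_strictMono_along_flow {x : M} {ℓ : ℝ} (hx : Φ ℓ x ≠ x) :
    ∃ f : M → ℝ, Continuous f ∧ ∃ ε > 0, ∃ N, IsOpen N ∧ x ∈ N ∧
      ∀ y ∈ N, ∀ t, 0 < t → t ≤ ε → f y < f (Φ t y) := by
  let := metrizableSpaceMetric M
  have hΦ := continuous_flow Φ
  have hcont : ∀ y, Continuous fun s ↦ dist x (Φ s y) := fun y ↦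
    continuous_const.dist (hΦ.comp (by fun_prop : Continuous fun s : ℝ ↦ (s, y)))
  have hopen : IsOpen {p : ℝ × M | dist x (Φ p.1 p.2) < dist x (Φ (p.1 + ℓ) p.2)} :=
    isOpen_lt (continuous_const.dist hΦ) (continuous_const.dist
      (hΦ.comp (by fun_prop : Continuous fun p : ℝ × M ↦ (p.1 + ℓ, p.2))))
  have h0 : ((0 : ℝ), x) ∈ {p : ℝ × M | dist x (Φ p.1 p.2) < dist x (Φ (p.1 + ℓ) p.2)} := by
    simp [Flow.map_zero_apply, dist_pos, hx.symm]
  obtain ⟨T, N, hT, hN, h0T, hxN, hTN⟩ := isOpen_prod_iff.1 hopen 0 x h0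
  obtain ⟨ε, hε, hεT⟩ := Metric.isOpen_iff.1 hT 0 h0T
  -- Along the flow this integral has derivative `dist x (Φ ℓ y) - dist x y`, which is positive for
  -- `y` near `x` because `Φ ℓ x ≠ x`.
  refine ⟨fun y ↦ ∫ s in (0 : ℝ)..ℓ, dist x (Φ s y), ?_, ε / 2, by positivity, N, hN, hxN, ?_⟩
  · refine intervalIntegral.continuous_parametric_intervalIntegral_of_continuous'
      (f := fun (y : M) (s : ℝ) ↦ dist x (Φ s y)) ?_ _ _
    exact continuous_const.dist (hΦ.comp continuous_swap)
  · intro y hy t ht htε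
    have hint : ∀ a b, IntervalIntegrable (fun s ↦ dist x (Φ s y)) MeasureTheory.volume a b :=
      fun a b ↦ (hcont y).intervalIntegrable a b
    have h1 : ∫ s in (0 : ℝ)..ℓ, dist x (Φ s (Φ t y)) = ∫ s in t..(t + ℓ), dist x (Φ s y) := by
      simp_rw [← Flow.map_add]
      rw [intervalIntegral.integral_comp_add_right (fun s ↦ dist x (Φ s y)), zero_add, add_comm]
    have h2 : (∫ s in t..(t + ℓ), dist x (Φ s y)) - ∫ s in (0 : ℝ)..ℓ, dist x (Φ s y) =
        (∫ s in (0 : ℝ)..t, dist x (Φ (s + ℓ) y)) - ∫ s in (0 : ℝ)..t, dist x (Φ s y) := by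
      rw [intervalIntegral.integral_interval_sub_interval_comm' (hint _ _) (hint _ _) (hint _ _),
        intervalIntegral.integral_comp_add_right (fun s ↦ dist x (Φ s y)), zero_add]
    have h3 : (∫ s in (0 : ℝ)..t, dist x (Φ s y)) < ∫ s in (0 : ℝ)..t, dist x (Φ (s + ℓ) y) := by
      have hlt : ∀ s ∈ Icc 0 t, dist x (Φ s y) < dist x (Φ (s + ℓ) y) := fun s hs ↦ by
        have : (s, y) ∈ T ×ˢ N := ⟨hεT (by
          rw [Metric.mem_ball, Real.dist_eq, sub_zero, abs_of_nonneg hs.1]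
          linarith [hs.2]), hy⟩
        exact hTN this
      refine intervalIntegral.integral_lt_integral_of_continuousOn_of_le_of_exists_lt ht
        (hcont y).continuousOn
        ((hcont y).comp (by fun_prop : Continuous fun s : ℝ ↦ s + ℓ)).continuousOn
        (fun s hs ↦ (hlt s ⟨hs.1.le, hs.2⟩).le) ⟨0, ⟨le_rfl, ht.le⟩, hlt 0 ⟨le_rfl, ht.le⟩⟩
    simp only [h1]
    linarith

/-- If `x` has no period in `(0, ℓ]`, then small sets near `x` have no short-time return
except immediate ones, along which a suitable function increases. -/
theorem exists_nhds_no_return {x : M} {ℓ : ℝ} (hℓ : 0 < ℓ)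
    (hx : ∀ t, 0 < t → t ≤ ℓ → Φ t x ≠ x) :
    ∃ f : M → ℝ, Continuous f ∧ ∃ N, IsOpen N ∧ x ∈ N ∧
      (∃ ε > 0, ∀ y ∈ N, ∀ t, 0 < t → t ≤ ε → f y < f (Φ t y)) ∧
      ∀ y ∈ N, ∀ t, 0 < t → t ≤ ℓ → f (Φ t y) ≤ f y → Φ t y ∉ N := by
  obtain ⟨f, hf, ε, hε, N, hN, hxN, hmono⟩ := exists_strictMono_along_flow Φ (hx ℓ hℓ le_rfl)
  have hΦ := continuous_flow Φ
  have hopen : IsOpen {p : ℝ × (M × M) | Φ p.1 p.2.1 ≠ p.2.2} :=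
    isOpen_ne_fun (hΦ.comp (by fun_prop : Continuous fun p : ℝ × (M × M) ↦ (p.1, p.2.1)))
      (by fun_prop)
  -- Compactness excludes returns at times in `[ε, ℓ]`; monotonicity of `f` handles the times below
  -- `ε`.
  obtain ⟨U, V, -, hV, hU, hxV, hUV⟩ := generalized_tube_lemma (isCompact_Icc (a := ε) (b := ℓ))
    (isCompact_singleton (x := (x, x))) hopen (by
      rintro ⟨t, p⟩ ⟨ht, rfl⟩
      exact hx t (hε.trans_le ht.1) ht.2)
  obtain ⟨V₁, V₂, hV₁, hV₂, hx₁, hx₂, hV₁₂⟩ := isOpen_prod_iff.1 hV x x (hxV rfl)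
  refine ⟨f, hf, N ∩ (V₁ ∩ V₂), hN.inter (hV₁.inter hV₂), ⟨hxN, hx₁, hx₂⟩,
    ⟨ε, hε, fun y hy ↦ hmono y hy.1⟩, ?_⟩
  intro y hy t ht htℓ hfy hyN
  rcases le_or_gt t ε with h | h
  · exact (hmono y hy.1 t ht h).not_ge hfy
  · exact hUV (mk_mem_prod (hU ⟨h.le, htℓ⟩) (hV₁₂ (mk_mem_prod hy.2.1 hyN.2.2))) rfl

theorem eventually_no_period {x : M} {ℓ : ℝ} (hℓ : 0 < ℓ)
    (hx : ∀ t, 0 < t → t ≤ ℓ → Φ t x ≠ x) :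
    ∀ᶠ y in 𝓝 x, ∀ t, 0 < t → t ≤ ℓ → Φ t y ≠ y := by
  obtain ⟨f, -, N, hN, hxN, -, h⟩ := exists_nhds_no_return Φ hℓ hx
  filter_upwards [hN.mem_nhds hxN] with y hy t ht htℓ heq
  exact h y hy t ht htℓ (by rw [heq]) (by rwa [heq])

/-- A local slice for the flow: a compact set `S` without return in time `(0, ℓ]`, whose points in
the open set `O` are transversal interior points, with a closed core `C`. -/
structure IsSlice (ℓ : ℝ) (S O C : Set M) : Prop where
  isCompact : IsCompact S
  isOpen : IsOpen O
  isClosed : IsClosed C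
  core_subset : C ⊆ S ∩ O
  no_return : ∀ y ∈ S, ∀ t, 0 < t → t ≤ ℓ → Φ t y ∉ S
  isOpen_sweep : ∀ V, IsOpen V → ∀ ε, IsOpen (image2 Φ (Ioo (-ε) ε) (S ∩ O ∩ V))

/-- The slice is a level set of the function `f` that increases along the flow, cut down to a
compact neighbourhood `K`. A return would repeat a value of `f`, which `hret` forbids; sweeps are
open because nearby orbits must cross the level, by the intermediate value theorem. -/
theorem exists_isSlice [LocallyCompactSpace M] {x : M} {ℓ a : ℝ} (hℓ : 0 < ℓ) (ha : 0 < a)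
    (hx : ∀ t, 0 < t → t ≤ ℓ → Φ t x ≠ x) {N₀ : Set M} (hN₀ : N₀ ∈ 𝓝 x) :
    ∃ S O C, IsSlice Φ ℓ S O C ∧ S ⊆ N₀ ∧ image2 Φ (Ioo (-a) a) C ∈ 𝓝 x := by
  obtain ⟨f, hf, N, hN, hxN, ⟨ε, hε, hmono⟩, hret⟩ := exists_nhds_no_return Φ hℓ hx
  have hΦ := continuous_flow Φ
  obtain ⟨K, hK, hKN, hKc⟩ := local_compact_nhds (Filter.inter_mem hN₀ (hN.mem_nhds hxN))
  have hopen : ∀ V, IsOpen V → ∀ δ,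
      IsOpen (image2 Φ (Ioo (-δ) δ) ((K ∩ {y | f y = f x}) ∩ interior K ∩ V)) := by
    intro V hV δ
    rw [isOpen_iff_mem_nhds]
    rintro _ ⟨s, hs, v, ⟨⟨⟨hvK, hvf⟩, hvi⟩, hvV⟩, rfl⟩
    have hnear : ∀ᶠ p in 𝓝 ((0 : ℝ), v), Φ p.1 p.2 ∈ interior K ∩ V :=
      hΦ.continuousAt.eventually_mem
        ((isOpen_interior.inter hV).mem_nhds (by simpa [Flow.map_zero_apply] using ⟨hvi, hvV⟩))
    obtain ⟨T, W, hT, h0T, hW, hvW, hTW⟩ := mem_nhds_prod_iff'.1 hnear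
    obtain ⟨η₁, hη₁, hηT⟩ := Metric.isOpen_iff.1 hT 0 h0T
    -- The three bounds keep the orbit in `interior K ∩ V`, keep `f` increasing, and keep the
    -- corrected time `s - t` inside `(-δ, δ)`.
    have hηb : 0 < min η₁ (min ε (δ - |s|)) := by
      refine lt_min hη₁ (lt_min hε (sub_pos.2 (abs_lt.2 hs)))
    obtain ⟨η, hη, hηlt⟩ := exists_between hηb
    have hη1 : η < η₁ := hηlt.trans_le (min_le_left _ _)
    have hη2 : η < ε := hηlt.trans_le ((min_le_right _ _).trans (min_le_left _ _))
    have hη3 : η < δ - |s| := hηlt.trans_le ((min_le_right _ _).trans (min_le_right _ _))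
    have hmemT : ∀ t ∈ Icc (-η) η, t ∈ T := fun t ht ↦ hηT (by
      rw [Metric.mem_ball, Real.dist_eq, sub_zero]
      exact (abs_le.2 ht).trans_lt hη1)
    have hin : ∀ t ∈ Icc (-η) η, ∀ w ∈ W, Φ t w ∈ interior K ∩ V := fun t ht w hw ↦
      hTW (mk_mem_prod (hmemT t ht) hw)
    have hlow : f (Φ (-η) v) < f x := by
      have := hmono (Φ (-η) v) (hKN (interior_subset (hin (-η) ⟨le_rfl, by linarith⟩ v hvW).1)).2
        η hη hη2.le
      rwa [← Flow.map_add, add_neg_cancel, Flow.map_zero_apply, hvf] at this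
    have hhigh : f x < f (Φ η v) := by
      have := hmono v (hKN hvK).2 η hη hη2.le
      rwa [hvf] at this
    have hev : ∀ᶠ y in 𝓝 (Φ s v), Φ (-s) y ∈ W ∧ f (Φ (-η) (Φ (-s) y)) < f x ∧
        f x < f (Φ η (Φ (-s) y)) := by
      have hcs : ∀ t, Continuous (Φ t) := fun t ↦ Φ.continuous_toFun t
      have hv : Φ (-s) (Φ s v) = v := by
        rw [← Flow.map_add, neg_add_cancel, Flow.map_zero_apply]
      refine ((hcs (-s)).continuousAt.eventually_mem (hW.mem_nhds (by rwa [hv]))).and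
        (((hf.comp ((hcs (-η)).comp (hcs (-s)))).continuousAt.eventually_lt_const
          (by simpa [hv] using hlow)).and
        ((hf.comp ((hcs η).comp (hcs (-s)))).continuousAt.eventually_const_lt
          (by simpa [hv] using hhigh)))
    filter_upwards [hev] with y ⟨hyW, hy1, hy2⟩
    have hct : ContinuousOn (fun t ↦ f (Φ t (Φ (-s) y))) (Icc (-η) η) :=
      (hf.comp (hΦ.comp (by fun_prop : Continuous fun t : ℝ ↦ (t, Φ (-s) y)))).continuousOn
    obtain ⟨t, ht, hft⟩ := intermediate_value_Icc (by linarith) hct ⟨hy1.le, hy2.le⟩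
    have hmem := hin t ht _ hyW
    have hts : |s - t| < δ := (abs_sub _ _).trans_lt (by linarith [abs_le.2 ht])
    refine ⟨s - t, abs_lt.1 hts, Φ t (Φ (-s) y),
      ⟨⟨⟨interior_subset hmem.1, hft⟩, hmem.1⟩, hmem.2⟩, ?_⟩
    rw [← Flow.map_add, ← Flow.map_add]
    ring_nf
    exact Flow.map_zero_apply _ _
  obtain ⟨K', hK', hK'K, hK'c⟩ := local_compact_nhds (interior_mem_nhds.2 hK)
  have hclosed : IsClosed {y | f y = f x} := isClosed_eq hf continuous_const
  refine ⟨K ∩ {y | f y = f x}, interior K, K' ∩ {y | f y = f x},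
    ⟨hKc.inter_right hclosed, isOpen_interior, hK'c.isClosed.inter hclosed, ?_, ?_, hopen⟩, ?_, ?_⟩
  · exact fun y hy ↦ ⟨⟨interior_subset (hK'K hy.1), hy.2⟩, hK'K hy.1⟩
  · intro y hy t ht htℓ hty
    exact hret y (hKN hy.1).2 t ht htℓ (by rw [hy.2, hty.2]) (hKN hty.1).2
  · exact fun y hy ↦ (hKN hy.1).1
  · refine Filter.mem_of_superset ((hopen (interior K') isOpen_interior a).mem_nhds
      ⟨0, by simpa using ha, x, ⟨⟨⟨mem_of_mem_nhds hK, rfl⟩, mem_interior_iff_mem_nhds.2 hK⟩,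
        mem_interior_iff_mem_nhds.2 hK'⟩, Flow.map_zero_apply _ _⟩) ?_
    exact image2_subset_left fun y hy ↦ ⟨interior_subset hy.2, hy.1.1.2⟩

end Slice

/-! ### Invariant sets that are zero-dimensional on slices. -/

section Decomposition

universe u

variable {M : Type u} [TopologicalSpace M] [MetrizableSpace M] (Φ : Flow ℝ M)

/-- Short holonomies between slices do not raise the dimension. -/
theorem hasSmallInductiveDimensionLT_inter_image2 {n : ℕ} {ℓ a b : ℝ} {S S' C : Set M}
    (hab : b - a ≤ ℓ) (hS : ∀ y ∈ S, ∀ t, 0 < t → t ≤ ℓ → Φ t y ∉ S)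
    (hS' : ∀ y ∈ S', ∀ t, 0 < t → t ≤ ℓ → Φ t y ∉ S') (hSc : IsClosed S) (hC : IsCompact C)
    (hCS : C ⊆ S') (h : HasSmallInductiveDimensionLT C n) :
    HasSmallInductiveDimensionLT ↥(S ∩ image2 Φ (Icc a b) C) n := by
  -- This compact set of pairs `(t, c)` injects into `C` because `S` has no short return, and maps
  -- bijectively to the target under `Φ` because `S'` has none; both maps are therefore embeddings.
  have hE : IsCompact {p : ℝ × M | p ∈ Icc a b ×ˢ C ∧ Φ p.1 p.2 ∈ S} :=
    (isCompact_Icc.prod hC).inter_right (hSc.preimage (continuous_flow Φ))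
  have := isCompact_iff_compactSpace.1 hE
  have hdimE : HasSmallInductiveDimensionLT {p : ℝ × M | p ∈ Icc a b ×ˢ C ∧ Φ p.1 p.2 ∈ S} n := by
    refine hasSmallInductiveDimensionLT_of_injective
      (f := fun p ↦ (⟨p.1.2, p.2.1.2⟩ : C)) (by fun_prop) ?_ h
    rintro ⟨⟨s, c⟩, hp⟩ ⟨⟨t, d⟩, hq⟩ hpq
    obtain rfl : c = d := congrArg Subtype.val hpq
    obtain rfl := injOn_flow_time Φ hab hS hp.1.1 hq.1.1 hp.2 hq.2
    rfl
  refine hasSmallInductiveDimensionLT_of_bijective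
    (f := fun p : {p : ℝ × M | p ∈ Icc a b ×ˢ C ∧ Φ p.1 p.2 ∈ S} ↦
      (⟨Φ p.1.1 p.1.2, p.2.2, mem_image2_of_mem p.2.1.1 p.2.1.2⟩ :
        ↥(S ∩ image2 Φ (Icc a b) C))) ?_ ⟨?_, ?_⟩ hdimE
  · exact ((continuous_flow Φ).comp continuous_subtype_val).subtype_mk _
  · rintro ⟨⟨s, c⟩, hp⟩ ⟨⟨t, d⟩, hq⟩ hpq
    have hcd : Φ s c = Φ t d := congrArg Subtype.val hpq
    have h1 : Φ (-s) (Φ s c) ∈ S' := by rw [flow_neg_apply]; exact hCS hp.1.2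
    have h2 : Φ (-t) (Φ s c) ∈ S' := by rw [hcd, flow_neg_apply]; exact hCS hq.1.2
    have hst : -s = -t := injOn_flow_time Φ (a := -b) (b := -a) (by linarith) hS'
      ⟨neg_le_neg hp.1.1.2, neg_le_neg hp.1.1.1⟩ ⟨neg_le_neg hq.1.1.2, neg_le_neg hq.1.1.1⟩ h1 h2
    obtain rfl := neg_injective hst
    obtain rfl : c = d := by rw [← flow_neg_apply Φ s c, hcd, flow_neg_apply]
    rfl
  · rintro ⟨_, hS, t, ht, c, hc, rfl⟩
    exact ⟨⟨(t, c), ⟨ht, hc⟩, hS⟩, rfl⟩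

theorem exists_countable_basis_frontier {n : ℕ} {A : Type u} [TopologicalSpace A]
    [SecondCountableTopology A] (h : HasSmallInductiveDimensionLT A (n + 1)) :
    ∃ b : Set (Set A), b.Countable ∧ IsTopologicalBasis b ∧
      ∀ U ∈ b, HasSmallInductiveDimensionLT (frontier U) n := by
  cases h with
  | succ _ s hs h =>
    obtain ⟨b, hbs, hbc, hb⟩ := hs.exists_countable
    exact ⟨b, hbc, hb, fun U hU ↦ h U (hbs hU)⟩

/-- Compact subsets of slices of dimension `< n` are covered by `n` flow invariant sets that are
zero-dimensional on every slice. -/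
theorem exists_invariant_decomposition [SecondCountableTopology M] {ι : Type*} [Countable ι]
    {S : ι → Set M} {ℓ : ℝ} (hℓ : 0 < ℓ) (hSc : ∀ i, IsCompact (S i))
    (hS : ∀ i, ∀ y ∈ S i, ∀ t, 0 < t → t ≤ ℓ → Φ t y ∉ S i) (n : ℕ) (𝒞 : Set (Set M))
    (h𝒞 : 𝒞.Countable) (hcpt : ∀ C ∈ 𝒞, IsCompact C) (hsub : ∀ C ∈ 𝒞, ∃ i, C ⊆ S i)
    (hdim : ∀ C ∈ 𝒞, HasSmallInductiveDimensionLT C n) :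
    ∃ Z : ℕ → Set M, (∀ k t, ∀ x ∈ Z k, Φ t x ∈ Z k) ∧
      (∀ k i, ClopenSeparated ↥(Z k ∩ S i)) ∧ ∀ C ∈ 𝒞, ∀ x ∈ C, ∃ k < n, x ∈ Z k := by
  induction n generalizing 𝒞 with
  | zero =>
    refine ⟨fun _ ↦ ∅, by simp, fun k i ↦ ?_, fun C hC x hx ↦ ?_⟩
    · have : IsEmpty ↥(∅ ∩ S i) := by simp
      exact clopenSeparated_of_isEmpty
    · have := hasSmallInductiveDimensionLT_zero_iff.1 (hdim C hC)
      exact (this.false ⟨x, hx⟩).elim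
  | succ n ih =>
    -- The traces on the slices of all flow translates of members of `𝒞`, cut into time windows of
    -- length `ℓ` so that the holonomy lemma applies. Induction is applied to the frontiers of their
    -- basic open sets.
    let D : ι × ℤ × 𝒞 → Set M := fun p ↦
      S p.1 ∩ image2 Φ (Icc (p.2.1 * ℓ) ((p.2.1 + 1) * ℓ)) p.2.2.1
    have : Countable 𝒞 := h𝒞.to_subtype
    have hDc : ∀ p, IsCompact (D p) := fun p ↦ (hSc _).inter_right
      (isCompact_image2_flow Φ isCompact_Icc (hcpt _ p.2.2.2)).isClosed
    have hDdim : ∀ p, HasSmallInductiveDimensionLT (D p) (n + 1) := fun p ↦ by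
      obtain ⟨i, hi⟩ := hsub _ p.2.2.2
      exact hasSmallInductiveDimensionLT_inter_image2 Φ (by linarith) (hS _) (hS i)
        (hSc _).isClosed (hcpt _ p.2.2.2) hi (hdim _ p.2.2.2)
    choose b hbc hb hbdim using fun p ↦ exists_countable_basis_frontier (hDdim p)
    obtain ⟨Z, hZinv, hZsep, hZcov⟩ := ih
      (⋃ p, (fun U : Set (D p) ↦ Subtype.val '' frontier U) '' b p)
      (countable_iUnion fun p ↦ (hbc p).image _)
      (by
        intro C hC
        obtain ⟨p, U, -, rfl⟩ := mem_iUnion.1 hC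
        have := isCompact_iff_compactSpace.1 (hDc p)
        exact isClosed_frontier.isCompact.image continuous_subtype_val)
      (by
        intro C hC
        obtain ⟨p, U, -, rfl⟩ := mem_iUnion.1 hC
        exact ⟨p.1, (Subtype.coe_image_subset _ _).trans inter_subset_left⟩)
      (by
        intro C hC
        obtain ⟨p, U, hU, rfl⟩ := mem_iUnion.1 hC
        exact hasSmallInductiveDimensionLT_of_isInducing
          (IsEmbedding.subtypeVal.homeomorphImage (frontier U)).symm.isInducing (hbdim p U hU))
    -- The saturation of `𝒞` minus the earlier invariant sets. Those contain all the frontiers, so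
    -- basic sets of each `D p` become clopen on `Y`; the sum theorem then treats `Y ∩ S i`.
    let Y : Set M := {x | (∃ t, ∃ C ∈ 𝒞, Φ t x ∈ C) ∧ ∀ k < n, x ∉ Z k}
    have hself : Function.update Z n Y n = Y := Function.update_self ..
    have hne : ∀ k ≠ n, Function.update Z n Y k = Z k := fun k hk ↦ Function.update_of_ne hk ..
    refine ⟨Function.update Z n Y, ?_, ?_, ?_⟩
    · intro k t x hx
      rcases eq_or_ne k n with hk | hk
      · rw [hk, hself] at hx ⊢
        obtain ⟨⟨s, C, hC, hsx⟩, hxZ⟩ := hx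
        refine ⟨⟨s - t, C, hC, by rwa [← Flow.map_add, sub_add_cancel]⟩, fun k hk hxk ↦ ?_⟩
        exact hxZ k hk (flow_neg_apply Φ t x ▸ hZinv k (-t) _ hxk)
      · rw [hne k hk] at hx ⊢
        exact hZinv k t x hx
    · intro k i
      rcases eq_or_ne k n with hk | hk
      · rw [hk, hself]
        refine clopenSeparated_of_countable_iUnion (ι := ℤ × 𝒞)
          (C := fun q ↦ Subtype.val ⁻¹' D (i, q)) ?_ ?_ ?_
        · exact fun q ↦ (hDc _).isClosed.preimage continuous_subtype_val
        · refine eq_univ_of_forall ?_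
          rintro ⟨x, ⟨⟨t, C, hC, htx⟩, hxZ⟩, hxS⟩
          refine mem_iUnion.2 ⟨(⌊-t / ℓ⌋, ⟨C, hC⟩), hxS, -t, ⟨?_, ?_⟩, Φ t x, htx,
            flow_neg_apply Φ t x⟩
          · exact (le_div_iff₀ hℓ).1 (Int.floor_le _)
          · exact ((div_lt_iff₀ hℓ).1 (Int.lt_floor_add_one _)).le
        · intro q
          let g : (Subtype.val ⁻¹' D (i, q) : Set ↥(Y ∩ S i)) → D (i, q) := fun x ↦ ⟨x.1.1, x.2⟩
          have hval := (IsInducing.subtypeVal (t := Y ∩ S i)).comp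
            (IsInducing.subtypeVal (t := (Subtype.val ⁻¹' D (i, q) : Set ↥(Y ∩ S i))))
          have hg : IsInducing g := IsInducing.subtypeVal.of_comp_iff.1 hval
          refine clopenSeparated_of_isTopologicalBasis ((hb (i, q)).isInducing hg) ?_
          rintro _ ⟨U, hU, rfl⟩
          rw [isClopen_iff_frontier_eq_empty, eq_empty_iff_forall_notMem]
          intro x hx
          obtain ⟨k, hk, hxk⟩ := hZcov _ (mem_iUnion.2 ⟨(i, q), U, hU, rfl⟩) _
            ⟨_, hg.continuous.frontier_preimage_subset U hx, rfl⟩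
          exact x.1.2.1.2 k hk hxk
      · rw [hne k hk]
        exact hZsep k i
    · intro C hC x hx
      by_cases h : ∃ k < n, x ∈ Z k
      · obtain ⟨k, hk, hxk⟩ := h
        exact ⟨k, hk.trans n.lt_succ_self, by rwa [hne k hk.ne]⟩
      · push Not at h
        refine ⟨n, n.lt_succ_self, ?_⟩
        rw [hself]
        exact ⟨⟨0, C, hC, by rwa [Flow.map_zero_apply]⟩, h⟩

end Decomposition

/-! ### Markers on the slices. -/

section Marker

variable {M : Type*} [TopologicalSpace M] (Φ : Flow ℝ M)

/-- A precompact set that is transversally open and has no boundary points in `Z`. -/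
structure IsMarker (Z A : Set M) : Prop where
  isCompact : IsCompact (closure A)
  closure_inter : closure A ∩ Z ⊆ A
  isOpen_sweep : ∀ ε, IsOpen (image2 Φ (Ioo (-ε) ε) A)

variable {Φ}

theorem IsMarker.empty (Z : Set M) : IsMarker Φ Z ∅ :=
  ⟨by simp, by simp, by simp⟩

theorem IsMarker.union {Z A B : Set M} (hA : IsMarker Φ Z A) (hB : IsMarker Φ Z B) :
    IsMarker Φ Z (A ∪ B) := by
  refine ⟨?_, ?_, fun ε ↦ ?_⟩
  · rw [closure_union]; exact hA.isCompact.union hB.isCompact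
  · rw [closure_union, union_inter_distrib_right]
    exact union_subset_union hA.closure_inter hB.closure_inter
  · rw [image2_union_right]; exact (hA.isOpen_sweep ε).union (hB.isOpen_sweep ε)

variable [MetrizableSpace M]

/-- Extends a marker set along a slice: the new part keeps time distance `c` from the old one, and
every core point in `Z` is new or has time distance less than `c'` from the old one. -/
theorem exists_marker_step {Z A : Set M} (hZ : ∀ t, ∀ x ∈ Z, Φ t x ∈ Z) {ℓ c c' : ℝ} (hc : c < c')
    {S O C : Set M} (hS : IsSlice Φ ℓ S O C) (hsep : ClopenSeparated ↥(Z ∩ S))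
    (hA : IsMarker Φ Z A) :
    ∃ W, IsMarker Φ Z W ∧ W ⊆ S ∧ (∀ w ∈ W, ∀ t, |t| ≤ c → Φ t w ∉ A) ∧
      ∀ z ∈ Z ∩ C, z ∈ W ∨ ∃ t, |t| < c' ∧ Φ t z ∈ A := by
  let := metrizableSpaceMetric M
  let F := image2 Φ (Icc (-c) c) (closure A)
  have hF : IsClosed F := (isCompact_image2_flow Φ isCompact_Icc hA.isCompact).isClosed
  let G := image2 Φ (Ioo (-c') c') A
  have hG : IsOpen G := hA.isOpen_sweep c'
  -- Within `Z`, the core points outside `G` miss `F`: invariance moves a point of `F ∩ Z` back to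
  -- `closure A ∩ Z ⊆ A`, and `c < c'`.
  obtain ⟨P, hP, hCP, hPd⟩ := hsep (Subtype.val ⁻¹' (C ∩ Gᶜ)) (Subtype.val ⁻¹' (Oᶜ ∪ F))
    ((hS.isClosed.inter hG.isClosed_compl).preimage continuous_subtype_val)
    ((hS.isOpen.isClosed_compl.union hF).preimage continuous_subtype_val) (by
      rw [disjoint_left]
      rintro ⟨z, hzZ, hzS⟩ ⟨hzC, hzG⟩ (hzO | ⟨t, ht, y, hy, hyz⟩)
      · exact hzO (hS.core_subset hzC).2
      · change Φ t y = z at hyz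
        have hyZ : y ∈ Z := by rw [← flow_neg_apply Φ t y, hyz]; exact hZ _ _ hzZ
        exact hzG ⟨t, ⟨by linarith [ht.1], by linarith [ht.2]⟩, y,
          hA.closure_inter ⟨hy, hyZ⟩, hyz⟩)
  -- Extends `P`, clopen only in `Z ∩ S`, to an open set of `M` whose closure meets `Z ∩ S` only in
  -- `P`.
  let V : Set M := {x | Metric.infEDist x (Subtype.val '' P) < Metric.infEDist x (Subtype.val '' Pᶜ)}
  have hV : IsOpen V := isOpen_lt Metric.continuous_infEDist Metric.continuous_infEDist
  have hpos : ∀ (Q : Set ↥(Z ∩ S)), IsClosed Q → ∀ x ∉ Q,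
      Metric.infEDist x.1 (Subtype.val '' Q) ≠ 0 := by
    intro Q hQ x hx h
    rw [← Metric.mem_closure_iff_infEDist_zero, ← closure_subtype, hQ.closure_eq] at h
    exact hx h
  have hPW : ∀ x ∈ P, x.1 ∈ S ∩ O ∩ (V ∩ Fᶜ) := by
    intro x hx
    have hn := hPd.notMem_of_mem_left hx
    simp only [mem_preimage, mem_union, mem_compl_iff, not_or, not_not] at hn
    refine ⟨⟨x.2.2, hn.1⟩, ?_, hn.2⟩
    have h0 : Metric.infEDist x.1 (Subtype.val '' P) = 0 :=
      Metric.infEDist_zero_of_mem (mem_image_of_mem _ hx)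
    change Metric.infEDist x.1 (Subtype.val '' P) < Metric.infEDist x.1 (Subtype.val '' Pᶜ)
    rw [h0]
    exact pos_iff_ne_zero.2 (hpos _ hP.compl.isClosed x (by simpa using hx))
  have hWS : S ∩ O ∩ (V ∩ Fᶜ) ⊆ S := fun x hx ↦ hx.1.1
  have hclS : closure (S ∩ O ∩ (V ∩ Fᶜ)) ⊆ S := closure_minimal hWS hS.isCompact.isClosed
  refine ⟨S ∩ O ∩ (V ∩ Fᶜ), ⟨hS.isCompact.of_isClosed_subset isClosed_closure hclS, ?_, ?_⟩,
    hWS, ?_, ?_⟩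
  · rintro y ⟨hy, hyZ⟩
    by_cases hyP : (⟨y, hyZ, hclS hy⟩ : ↥(Z ∩ S)) ∈ P
    · exact hPW _ hyP
    · have hle : Metric.infEDist y (Subtype.val '' P) ≤ Metric.infEDist y (Subtype.val '' Pᶜ) :=
        closure_minimal (fun x hx ↦ le_of_lt hx.2.1)
          (isClosed_le Metric.continuous_infEDist Metric.continuous_infEDist) hy
      have h0 : Metric.infEDist y (Subtype.val '' Pᶜ) = 0 :=
        Metric.infEDist_zero_of_mem ⟨⟨y, hyZ, hclS hy⟩, hyP, rfl⟩
      exact (hpos P hP.isClosed _ hyP (le_zero_iff.1 (h0 ▸ hle))).elim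
  · exact fun ε ↦ hS.isOpen_sweep _ (hV.inter hF.isOpen_compl) ε
  · intro w hw t ht htw
    refine hw.2.2 ⟨-t, abs_le.1 (by rwa [abs_neg]), _, subset_closure htw, flow_neg_apply Φ t w⟩
  · rintro z ⟨hzZ, hzC⟩
    by_cases hzG : z ∈ G
    · obtain ⟨t, ht, y, hy, rfl⟩ := hzG
      exact .inr ⟨-t, by rw [abs_neg]; exact abs_lt.2 ht, by rwa [flow_neg_apply]⟩
    · exact .inl (hPW ⟨z, hzZ, (hS.core_subset hzC).1⟩ (hCP ⟨hzC, hzG⟩))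

/-- Greedy choice: the marker on slice `i` avoids the union `A i` of all earlier ones, and core
points it omits are already close to that union. -/
theorem exists_markers {Z : Set M} (hZ : ∀ t, ∀ x ∈ Z, Φ t x ∈ Z) {ℓ c c' : ℝ} (hc : c < c')
    (hc' : 0 < c') {S O C : ℕ → Set M} (hS : ∀ i, IsSlice Φ ℓ (S i) (O i) (C i))
    (hsep : ∀ i, ClopenSeparated ↥(Z ∩ S i)) :
    ∃ W : ℕ → Set M, (∀ i, IsMarker Φ Z (W i)) ∧ (∀ i, W i ⊆ S i) ∧
      (∀ i j, j < i → ∀ w ∈ W i, ∀ t, |t| ≤ c → Φ t w ∉ W j) ∧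
      ∀ i, ∀ z ∈ Z ∩ C i, ∃ j t, |t| < c' ∧ Φ t z ∈ W j := by
  choose W hW hWS hWA hWC using
    fun (i : ℕ) (A : {A // IsMarker Φ Z A}) ↦ exists_marker_step hZ hc (hS i) (hsep i) A.2
  let A : ℕ → {A // IsMarker Φ Z A} := fun i ↦
    Nat.rec ⟨∅, .empty Z⟩ (fun i A ↦ ⟨A.1 ∪ W i A, A.2.union (hW i A)⟩) i
  have hAmono : Monotone fun i ↦ (A i).1 := monotone_nat_of_le_succ fun i ↦ subset_union_left
  have hAW : ∀ i, ∀ x ∈ (A i).1, ∃ j < i, x ∈ W j (A j) := by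
    intro i
    induction i with
    | zero => exact fun x hx ↦ hx.elim
    | succ i ih =>
      rintro x (hx | hx)
      · obtain ⟨j, hj, hxj⟩ := ih x hx
        exact ⟨j, hj.trans i.lt_succ_self, hxj⟩
      · exact ⟨i, i.lt_succ_self, hx⟩
  refine ⟨fun i ↦ W i (A i), fun i ↦ hW i _, fun i ↦ hWS i _, ?_, ?_⟩
  · intro i j hji w hw t ht htw
    exact hWA i _ w hw t ht (hAmono (Nat.succ_le_of_lt hji) (.inr htw))
  · intro i z hz
    rcases hWC i (A i) z hz with h | ⟨t, ht, htz⟩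
    · exact ⟨i, 0, by simpa using hc', by rwa [Flow.map_zero_apply]⟩
    · obtain ⟨j, -, hj⟩ := hAW i _ htz
      exact ⟨j, t, ht, hj⟩

end Marker

/-! ### Boxes over markers and their multiplicity. -/

section Cover

universe u

variable {M : Type u} [TopologicalSpace M] {Φ : Flow ℝ M}

/-- The boxes around `c`-separated markers have bounded multiplicity. -/
theorem encard_boxes_le {N : ℕ} {α : ℝ} (hα : 0 < α) {W : ℕ → ℕ → Set M}
    (hW : ∀ k i j, j < i → ∀ w ∈ W k i, ∀ t, |t| ≤ 2 * α → Φ t w ∉ W k j) (x : M) :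
    {V ∈ {V | ∃ k < N, ∃ i, V = image2 Φ (Ioo (-(5 * α)) (5 * α)) (W k i)} | x ∈ V}.encard
      ≤ (5 * N : ℕ) := by
  have hch : ∀ V ∈ {V ∈ {V | ∃ k < N, ∃ i, V = image2 Φ (Ioo (-(5 * α)) (5 * α)) (W k i)} | x ∈ V},
      ∃ k < N, ∃ i, V = image2 Φ (Ioo (-(5 * α)) (5 * α)) (W k i) ∧
        ∃ t, 0 < t ∧ t < 10 * α ∧ Φ (t - 5 * α) x ∈ W k i := by
    rintro V ⟨⟨k, hk, i, rfl⟩, s, hs, w, hw, hwx⟩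
    -- The hitting time is shifted into `(0, 10α)`, which splits into five cells of length `2α`. For
    -- fixed `k`, hits in the same cell belong to the same marker.
    refine ⟨k, hk, i, rfl, 5 * α - s, by linarith [hs.2], by linarith [hs.1], ?_⟩
    have : 5 * α - s - 5 * α = -s := by ring
    rwa [this, ← hwx, flow_neg_apply]
  choose! k hk i hV t ht0 ht htW using hch
  have hmem : ∀ V ∈ {V ∈ {V | ∃ k < N, ∃ i, V = image2 Φ (Ioo (-(5 * α)) (5 * α)) (W k i)} | x ∈ V},
      ⌊t V / (2 * α)⌋₊ < 5 := fun V hV ↦ by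
    rw [Nat.floor_lt (by have := ht0 V hV; positivity), div_lt_iff₀ (by positivity)]
    push_cast
    linarith [ht V hV]
  refine (encard_le_encard_of_injOn (t := ((Finset.range N ×ˢ Finset.range 5 : Finset (ℕ × ℕ)) :
    Set (ℕ × ℕ))) (f := fun V ↦ (k V, ⌊t V / (2 * α)⌋₊)) ?_ ?_).trans ?_
  · intro V hV
    simpa using ⟨hk V hV, hmem V hV⟩
  · intro V hVm V' hVm' heq
    obtain ⟨hkk, hff⟩ := Prod.mk.inj heq
    have hlt : |t V' - t V| ≤ 2 * α := by
      have h1 := Nat.floor_le (a := t V / (2 * α)) (by have := ht0 V hVm; positivity)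
      have h2 := Nat.lt_floor_add_one (t V / (2 * α))
      have h3 := Nat.floor_le (a := t V' / (2 * α)) (by have := ht0 V' hVm'; positivity)
      have h4 := Nat.lt_floor_add_one (t V' / (2 * α))
      rw [← hff] at h3 h4
      rw [le_div_iff₀ (by positivity)] at h1 h3
      rw [div_lt_iff₀ (by positivity)] at h2 h4
      rw [abs_le]
      constructor <;> linarith
    have hflow : ∀ s s', Φ (s' - s) (Φ (s - 5 * α) x) = Φ (s' - 5 * α) x := fun s s' ↦ by
      rw [← Flow.map_add]; ring_nf
    have hii : i V = i V' := by
      rcases lt_trichotomy (i V) (i V') with h | h | h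
      · refine (hW (k V) _ _ h _ (hkk ▸ htW V' hVm') (t V - t V') ?_ ?_).elim
        · rwa [abs_sub_comm]
        · rw [hflow]; exact htW V hVm
      · exact h
      · refine (hW (k V) _ _ h _ (htW V hVm) (t V' - t V) hlt ?_).elim
        rw [hflow, hkk]; exact htW V' hVm'
    rw [hV V hVm, hV V' hVm', hkk, hii]
  · rw [encard_coe_eq_coe_finsetCard, Finset.card_product, Finset.card_range, Finset.card_range,
      mul_comm]

variable [MetrizableSpace M]

theorem exists_isSlice_of_forall_mem [LocallyCompactSpace M] {α : ℝ} (hα : 0 < α) {x : M}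
    (hx : ∀ t, 0 < t → t ≤ 20 * α → Φ t x ≠ x) {O : Set M} (hO : IsOpen O)
    (hxO : ∀ t ∈ Icc (-(5 * α)) (5 * α), Φ t x ∈ O) :
    ∃ S O' C, IsSlice Φ (20 * α) S O' C ∧ image2 Φ (Icc (-(5 * α)) (5 * α)) S ⊆ O ∧
      image2 Φ (Ioo (-α) α) C ∈ 𝓝 x := by
  have hnear : ∀ᶠ y in 𝓝 x, ∀ t ∈ Icc (-(5 * α)) (5 * α), Φ t y ∈ O := by
    refine isCompact_Icc.eventually_forall_of_forall_eventually fun t ht ↦ ?_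
    exact ((continuous_flow Φ).comp continuous_swap).continuousAt.eventually_mem
      (hO.mem_nhds (hxO t ht))
  obtain ⟨S, O', C, hS, hSN, hC⟩ := exists_isSlice Φ (by positivity) hα hx hnear
  exact ⟨S, O', C, hS, image2_subset_iff.2 fun t ht y hy ↦ hSN hy t ht, hC⟩

/-- Long thin covers for flows without short periods. -/
theorem exists_long_thin_cover [SecondCountableTopology M] [LocallyCompactSpace M] (n : ℕ)
    {𝒦 : Set (Set M)} (h𝒦 : 𝒦.Countable) (hcpt : ∀ K ∈ 𝒦, IsCompact K)
    (hdim : ∀ K ∈ 𝒦, HasSmallInductiveDimensionLT K n) (hcov : ⋃₀ 𝒦 = univ) {α : ℝ} (hα : 0 < α)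
    {Y : Set M} (hY : ∀ x ∈ Y, ∀ t, 0 < t → t ≤ 20 * α → Φ t x ≠ x) {P : Set M → Prop}
    (hP : ∀ x ∈ Y, ∃ O, IsOpen O ∧ P O ∧ ∀ t ∈ Icc (-(5 * α)) (5 * α), Φ t x ∈ O) :
    ∃ 𝒱 : Set (Set M), (∀ V ∈ 𝒱, IsOpen V ∧ ∃ O, P O ∧ V ⊆ O) ∧
      (∀ x, {V ∈ 𝒱 | x ∈ V}.encard ≤ (5 * n : ℕ)) ∧
      ∀ x ∈ Y, ∃ V ∈ 𝒱, ∀ t ∈ Icc (-α) α, Φ t x ∈ V := by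
  rcases Y.eq_empty_or_nonempty with rfl | hne
  · exact ⟨∅, by simp, by simp, by simp⟩
  have hex : ∀ x : Y, ∃ S O C, IsSlice Φ (20 * α) S O C ∧
      (∃ O, P O ∧ image2 Φ (Icc (-(5 * α)) (5 * α)) S ⊆ O) ∧
      image2 Φ (Ioo (-α) α) C ∈ 𝓝 x.1 := by
    intro x
    obtain ⟨O, hO, hPO, hxO⟩ := hP x x.2
    obtain ⟨S, O', C, hS, hSO, hC⟩ := exists_isSlice_of_forall_mem hα (hY x x.2) hO hxO
    exact ⟨S, O', C, hS, ⟨O, hPO, hSO⟩, hC⟩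
  choose S₀ O₀ C₀ hS₀ hSP₀ hC₀ using hex
  obtain ⟨t, htc, ht⟩ := TopologicalSpace.countable_cover_nhds
    fun x : Y ↦ preimage_coe_mem_nhds_subtype.2 (mem_nhdsWithin_of_mem_nhds (hC₀ x))
  have htne : t.Nonempty := by
    obtain ⟨x, hx⟩ := hne
    obtain ⟨y, hy, -⟩ := mem_iUnion₂.1 (ht.symm ▸ mem_univ (⟨x, hx⟩ : Y))
    exact ⟨y, hy⟩
  obtain ⟨u, rfl⟩ := htc.exists_eq_range htne
  have hYC : ∀ x ∈ Y, ∃ i, x ∈ image2 Φ (Ioo (-α) α) (C₀ (u i)) := by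
    intro x hx
    obtain ⟨_, ⟨i, rfl⟩, hi⟩ := mem_iUnion₂.1 (ht.symm ▸ mem_univ (⟨x, hx⟩ : Y))
    exact ⟨i, hi⟩
  have hS : ∀ i, IsSlice Φ (20 * α) (S₀ (u i)) (O₀ (u i)) (C₀ (u i)) := fun i ↦ hS₀ _
  have hcount : (image2 (fun i K ↦ S₀ (u i) ∩ K) univ 𝒦).Countable :=
    Set.countable_univ.image2 h𝒦 _
  obtain ⟨Z, hZ, hZsep, hZcov⟩ := exists_invariant_decomposition Φ (ℓ := 20 * α) (by positivity)
    (fun i ↦ (hS i).isCompact) (fun i ↦ (hS i).no_return) n _ hcount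
    (by
      rintro _ ⟨i, -, K, hK, rfl⟩
      exact (hS i).isCompact.inter (hcpt K hK))
    (by
      rintro _ ⟨i, -, K, hK, rfl⟩
      exact ⟨i, inter_subset_left⟩)
    (by
      rintro _ ⟨i, -, K, hK, rfl⟩
      exact hasSmallInductiveDimensionLT_of_isInducing
        (IsEmbedding.inclusion (inter_subset_right (s := S₀ (u i)) (t := K))).isInducing
        (hdim K hK))
  choose W hW hWS hWsep hWcov using fun k ↦ exists_markers (hZ k)
    (by linarith : 2 * α < 3 * α) (by linarith) hS (hZsep k)
  refine ⟨{V | ∃ k < n, ∃ i, V = image2 Φ (Ioo (-(5 * α)) (5 * α)) (W k i)}, ?_,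
    encard_boxes_le hα hWsep, ?_⟩
  · rintro _ ⟨k, -, i, rfl⟩
    obtain ⟨O, hO, hSO⟩ := hSP₀ (u i)
    exact ⟨(hW k i).isOpen_sweep _, O, hO, (image2_subset Ioo_subset_Icc_self (hWS k i)).trans hSO⟩
  · intro x hx
    obtain ⟨i, s, hs, z, hz, rfl⟩ := hYC x hx
    obtain ⟨K, hK, hzK⟩ := mem_sUnion.1 (hcov.symm ▸ mem_univ z)
    have hzS := ((hS i).core_subset hz).1
    obtain ⟨k, hk, hzk⟩ := hZcov _ ⟨i, mem_univ _, K, hK, rfl⟩ z ⟨hzS, hzK⟩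
    obtain ⟨j, r, hr, hrz⟩ := hWcov k i z ⟨hzk, hz⟩
    -- Here `|t| ≤ α`, `|s| < α` and `|r| < 3α`, which accounts for the half-length `5α`.
    refine ⟨_, ⟨k, hk, j, rfl⟩, fun t ht ↦ ⟨t + s - r, ?_, _, hrz, ?_⟩⟩
    · have := abs_lt.1 hr
      constructor <;> linarith [hs.1, hs.2, ht.1, ht.2]
    · rw [← Flow.map_add, ← Flow.map_add, sub_add_cancel]

end Cover

/-! ### The orbit space and its induced flow. -/

section OrbitSpace

universe u

variable {G : Type*} {X : Type u} [Group G] [MulAction G X]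

theorem orbitMk_eq_iff {x y : X} :
    orbitMk G x = orbitMk G y ↔ ∃ g : G, g • y = x :=
  Quotient.eq.trans Iff.rfl

theorem orbitMk_smul (g : G) (x : X) : orbitMk G (g • x) = orbitMk G x :=
  orbitMk_eq_iff.2 ⟨g, rfl⟩

theorem preimage_orbitMk_smul_set (V : Set (MulAction.orbitRel.Quotient G X))
    (g : G) : g • (orbitMk G ⁻¹' V) = orbitMk G ⁻¹' V := by
  ext x
  rw [mem_smul_set_iff_inv_smul_mem, mem_preimage, mem_preimage, orbitMk_smul]

theorem IsFamilySubset.eq_of_inter {𝓕 : Set (Subgroup G)} {U : Set X} (hU : IsFamilySubset 𝓕 U)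
    {g h : G} (hgh : (g • U ∩ h • U).Nonempty) : g • U = h • U := by
  have : ((h⁻¹ * g) • U ∩ U).Nonempty := by
    obtain ⟨x, hxg, hxh⟩ := hgh
    refine ⟨h⁻¹ • x, ?_, mem_smul_set_iff_inv_smul_mem.1 hxh⟩
    rw [mul_smul]
    exact smul_mem_smul_set hxg
  rw [← mul_inv_cancel_left h g, mul_smul, hU.1 _ this]

theorem IsFamilySubset.smul_fin {U : Set X} (hU : IsFamilySubset (finFamily G) U) (g : G) :
    IsFamilySubset (finFamily G) (g • U) := by
  refine ⟨fun h hh ↦ ?_, ?_⟩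
  · rw [smul_smul] at hh ⊢
    exact hU.eq_of_inter hh
  · have : Finite (MulAction.stabilizer G U) := hU.2
    rw [MulAction.stabilizer_smul_eq_stabilizer_map_conj]
    exact Finite.of_surjective _
      (((MulAut.conj g).toMonoidHom.subgroupMap_surjective (MulAction.stabilizer G U)))

/-- Nonemptiness matters: the stabilizer of the empty set is all of `G`. -/
theorem IsFamilySubset.inter_fin {U A : Set X} (hU : IsFamilySubset (finFamily G) U)
    (hA : ∀ g : G, g • A = A) (hne : (U ∩ A).Nonempty) :
    IsFamilySubset (finFamily G) (U ∩ A) := by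
  have hstab : ∀ g : G, (g • (U ∩ A) ∩ (U ∩ A)).Nonempty → g • U = U := fun g hg ↦
    hU.1 g (hg.mono (inter_subset_inter (smul_set_mono inter_subset_left) inter_subset_left))
  refine ⟨fun g hg ↦ by rw [smul_set_inter, hstab g hg, hA], ?_⟩
  have : (MulAction.stabilizer G U : Set G).Finite :=
    have : Finite (MulAction.stabilizer G U) := hU.2
    Set.toFinite _
  refine (this.subset fun g hg ↦ hstab g ?_ :
    (MulAction.stabilizer G (U ∩ A) : Set G).Finite).to_subtype
  rw [show g • (U ∩ A) = U ∩ A from hg, inter_self]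
  exact hne

variable [MetricSpace X] {Φ : Flow ℝ X}

namespace IsFlowSpace

theorem continuousConstSMul (hΦ : IsFlowSpace G Φ) : ContinuousConstSMul G X :=
  ⟨fun g ↦ (hΦ.isometry g).continuous⟩

theorem properlyDiscontinuousSMul (hΦ : IsFlowSpace G Φ) : ProperlyDiscontinuousSMul G X := by
  refine properlyDiscontinuousSMul_iff.2 fun {K L} hK hL ↦
    (hΦ.proper _ (hK.union hL)).subset ?_
  rintro g ⟨x, hx, hxL⟩
  exact ⟨x, .inr hxL, smul_set_mono subset_union_left hx⟩

theorem isOpenQuotientMap_orbitMk (hΦ : IsFlowSpace G Φ) : IsOpenQuotientMap (orbitMk G (X := X)) :=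
  have := hΦ.continuousConstSMul
  MulAction.isOpenQuotientMap_quotientMk

/-- The flow induced on the orbit space. -/
def orbitFlow (hΦ : IsFlowSpace G Φ) : Flow ℝ (MulAction.orbitRel.Quotient G X) where
  toFun t := Quotient.map (Φ t) (by
    rintro _ y ⟨g, rfl⟩
    exact ⟨g, (hΦ.comm g t y).symm⟩)
  cont' := by
    rw [← (IsOpenQuotientMap.id.prodMap hΦ.isOpenQuotientMap_orbitMk).continuous_comp_iff]
    exact hΦ.isOpenQuotientMap_orbitMk.continuous.comp Φ.cont'
  map_add' t s := by
    rintro ⟨x⟩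
    exact congrArg (orbitMk G) (Φ.map_add t s x)
  map_zero' := by
    rintro ⟨x⟩
    exact congrArg (orbitMk G) (Φ.map_zero_apply x)

theorem orbitFlow_orbitMk (hΦ : IsFlowSpace G Φ) (t : ℝ) (x : X) :
    hΦ.orbitFlow t (orbitMk G x) = orbitMk G (Φ t x) := rfl

theorem secondCountableTopology_orbit [SecondCountableTopology X] (hΦ : IsFlowSpace G Φ) :
    SecondCountableTopology (MulAction.orbitRel.Quotient G X) :=
  have := hΦ.continuousConstSMul
  ContinuousConstSMul.secondCountableTopology

/-- The margin `γ' > γ` makes the condition on the infimum equivalent to one on individual times;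
`mem_longPart_of_no_period` is the converse. -/
theorem exists_no_period (hΦ : IsFlowSpace G Φ) {γ : ℝ} {x : X} (hx : x ∈ longPart G Φ γ) :
    ∃ γ' > γ, ∀ t, 0 < t → t ≤ γ' → hΦ.orbitFlow t (orbitMk G x) ≠ orbitMk G x := by
  have hx' : (γ : EReal) < gPeriod G Φ x := not_le.1 hx
  obtain ⟨γ', h1, h2⟩ := EReal.lt_iff_exists_real_btwn.1 hx'
  refine ⟨γ', EReal.coe_lt_coe_iff.1 h1, fun t ht htγ h ↦ ?_⟩
  have : gPeriod G Φ x ≤ (t : EReal) := sInf_le ⟨t, ht, h, rfl⟩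
  exact (h2.trans_le this).not_ge (EReal.coe_le_coe_iff.2 htγ)

theorem mem_longPart_of_no_period (hΦ : IsFlowSpace G Φ) {γ γ' : ℝ} (hγ : γ < γ') {x : X}
    (hx : ∀ t, 0 < t → t ≤ γ' → hΦ.orbitFlow t (orbitMk G x) ≠ orbitMk G x) :
    x ∈ longPart G Φ γ := by
  have : (γ' : EReal) ≤ gPeriod G Φ x := by
    refine le_sInf ?_
    rintro _ ⟨t, ht, h, rfl⟩
    exact EReal.coe_le_coe_iff.2 (le_of_not_ge fun htγ ↦ hx t ht htγ h)
  exact not_le.2 ((EReal.coe_lt_coe_iff.2 hγ).trans_le this)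

theorem flow_mem_longPart (hΦ : IsFlowSpace G Φ) {γ : ℝ} {x : X} (hx : x ∈ longPart G Φ γ) (s : ℝ) :
    Φ s x ∈ longPart G Φ γ := by
  obtain ⟨γ', hγγ', hγ'⟩ := hΦ.exists_no_period hx
  refine hΦ.mem_longPart_of_no_period hγγ' fun t ht htγ h ↦ hγ' t ht htγ ?_
  rw [← hΦ.orbitFlow_orbitMk, ← Flow.map_add, add_comm, Flow.map_add] at h
  rw [← flow_neg_apply hΦ.orbitFlow s (hΦ.orbitFlow t _), h, flow_neg_apply]

theorem smul_mem_longPart (hΦ : IsFlowSpace G Φ) {γ : ℝ} {x : X} (hx : x ∈ longPart G Φ γ) (g : G) :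
    g • x ∈ longPart G Φ γ := by
  obtain ⟨γ', hγγ', hγ'⟩ := hΦ.exists_no_period hx
  exact hΦ.mem_longPart_of_no_period hγγ' (by rwa [orbitMk_smul])

variable [LocallyCompactSpace X]

theorem t2Space_orbit (hΦ : IsFlowSpace G Φ) : T2Space (MulAction.orbitRel.Quotient G X) :=
  have := hΦ.continuousConstSMul
  have := hΦ.properlyDiscontinuousSMul
  t2Space_of_properlyDiscontinuousSMul_of_t2Space

theorem locallyCompactSpace_orbit (hΦ : IsFlowSpace G Φ) :
    LocallyCompactSpace (MulAction.orbitRel.Quotient G X) :=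
  have := hΦ.t2Space_orbit
  have := hΦ.isOpenQuotientMap_orbitMk.weaklyLocallyCompactSpace
  inferInstance

theorem metrizableSpace_orbit [SecondCountableTopology X] (hΦ : IsFlowSpace G Φ) :
    MetrizableSpace (MulAction.orbitRel.Quotient G X) :=
  have := hΦ.t2Space_orbit
  have := hΦ.locallyCompactSpace_orbit
  have := hΦ.secondCountableTopology_orbit
  metrizableSpace_of_t3_secondCountable _

theorem isOpen_longPart [SecondCountableTopology X] (hΦ : IsFlowSpace G Φ) {γ : ℝ} (hγ : 0 ≤ γ) :
    IsOpen (longPart G Φ γ) := by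
  have := hΦ.metrizableSpace_orbit
  rw [isOpen_iff_mem_nhds]
  intro x hx
  obtain ⟨γ', hγγ', hγ'⟩ := hΦ.exists_no_period hx
  have := hΦ.isOpenQuotientMap_orbitMk.continuous.continuousAt.eventually
    (eventually_no_period hΦ.orbitFlow (hγ.trans_lt hγγ') hγ')
  filter_upwards [this] with y hy
  exact hΦ.mem_longPart_of_no_period hγγ' hy

/-- The orbit space is covered by countably many compact sets of dimension at most that of `X`. -/
theorem exists_compact_cover_orbit [SecondCountableTopology X] (hΦ : IsFlowSpace G Φ) {n : ℕ}
    (hn : HasSmallInductiveDimensionLT X n) :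
    ∃ 𝒦 : Set (Set (MulAction.orbitRel.Quotient G X)), 𝒦.Countable ∧ (∀ K ∈ 𝒦, IsCompact K) ∧
      (∀ K ∈ 𝒦, HasSmallInductiveDimensionLT K n) ∧ ⋃₀ 𝒦 = univ := by
  have := hΦ.continuousConstSMul
  have := hΦ.properlyDiscontinuousSMul
  have := hΦ.t2Space_orbit
  -- The orbit map is injective on `U ∩ E U`, and `E U` is closed for open `U`. By proper
  -- discontinuity each `x` lies in `E U` for a small `U` around it.
  let E : Set X → Set X := fun U ↦ {x | ∀ g : G, g • x ∈ U → g • x = x}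
  have hE : ∀ U, IsOpen U → IsClosed (E U) := by
    intro U hU
    have : E U = ⋂ g : G, ({x | g • x ∈ U}ᶜ ∪ {x | g • x = x}) := by
      ext x
      simp [E, imp_iff_not_or]
    rw [this]
    exact isClosed_iInter fun g ↦ ((hU.preimage (continuous_const_smul g)).isClosed_compl).union
      (isClosed_eq (continuous_const_smul g) continuous_id)
  let B := countableBasis X
  have hB := isBasis_countableBasis X
  let D : Set (Set X × Set X) :=
    {p | p ∈ B ×ˢ B ∧ IsCompact (closure p.2) ∧ closure p.2 ⊆ p.1}
  have hcpt : ∀ p ∈ D, IsCompact (closure p.2 ∩ E p.1) := fun p hp ↦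
    hp.2.1.inter_right (hE _ (hB.isOpen hp.1.1))
  have hcont := hΦ.isOpenQuotientMap_orbitMk.continuous
  refine ⟨(fun p : Set X × Set X ↦ orbitMk G '' (closure p.2 ∩ E p.1)) '' D, ?_, ?_, ?_, ?_⟩
  · exact (((countable_countableBasis X).prod (countable_countableBasis X)).mono
      fun p hp ↦ hp.1).image _
  · rintro _ ⟨p, hp, rfl⟩
    exact (hcpt p hp).image hcont
  · rintro _ ⟨p, hp, rfl⟩
    have := isCompact_iff_compactSpace.1 (hcpt p hp)
    have hinj : InjOn (orbitMk G) (closure p.2 ∩ E p.1) := by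
      intro x hx y hy hxy
      obtain ⟨g, rfl⟩ := orbitMk_eq_iff.1 hxy
      exact hy.2 g (hp.2.2 hx.1)
    exact hasSmallInductiveDimensionLT_of_bijective
      (hcont.restrict (mapsTo_image _ _)) hinj.bijOn_image.bijective
      (hasSmallInductiveDimensionLT_of_isInducing IsInducing.subtypeVal hn)
  · refine eq_univ_of_forall ?_
    rintro ⟨x⟩
    obtain ⟨U₀, hU₀, hUfix⟩ := ProperlyDiscontinuousSMul.exists_nhds_image_smul_eq_self G x
    obtain ⟨U, hU, hxU, hUU₀⟩ := hB.mem_nhds_iff.1 hU₀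
    obtain ⟨K, hK, hKU, hKc⟩ := local_compact_nhds ((hB.isOpen hU).mem_nhds hxU)
    obtain ⟨V, hV, hxV, hVK⟩ := hB.mem_nhds_iff.1 hK
    have hcl : closure V ⊆ K := closure_minimal hVK hKc.isClosed
    exact ⟨_, ⟨(U, V), ⟨⟨hU, hV⟩, hKc.of_isClosed_subset isClosed_closure hcl, hcl.trans hKU⟩, rfl⟩,
      x, ⟨subset_closure hxV, fun g hg ↦ hUfix g ⟨g • x, ⟨x, hUU₀ hxU, rfl⟩, hUU₀ hg⟩⟩, rfl⟩

/-- A flow segment shorter than the `G`-period has a neighbourhood that is a `Fin`-subset. -/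
theorem exists_isFamilySubset_segment [SecondCountableTopology X] (hΦ : IsFlowSpace G Φ) {γ b : ℝ}
    (hb : 0 ≤ b) (hbγ : 2 * b ≤ γ) {x : X} (hx : x ∈ longPart G Φ γ) :
    ∃ U, IsOpen U ∧ IsFamilySubset (finFamily G) U ∧ U ⊆ longPart G Φ γ ∧
      ∀ t ∈ Icc (-b) b, Φ t x ∈ U := by
  obtain ⟨γ', hγγ', hγ'⟩ := hΦ.exists_no_period hx
  let K := image2 Φ (Icc (-b) b) {x}
  have hK : IsCompact K := isCompact_image2_flow Φ isCompact_Icc isCompact_singleton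
  have hxK : ∀ t ∈ Icc (-b) b, Φ t x ∈ K := fun t ht ↦ ⟨t, ht, x, rfl, rfl⟩
  have hx0 : x ∈ K := by simpa [Flow.map_zero_apply] using hxK 0 ⟨by linarith, hb⟩
  -- A common point gives `Φ r x = g • x` with `|r| ≤ 2b ≤ γ < γ'`. The period bound forces `r = 0`,
  -- hence `g • x = x`.
  have hstab : ∀ g : G, g • x ≠ x → Disjoint (g • K) K := by
    intro g hg
    rw [disjoint_left]
    rintro _ ⟨_, ⟨s, hs, x, rfl, rfl⟩, rfl⟩ ⟨t, ht, x, rfl, htx⟩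
    change Φ t x = g • Φ s x at htx
    have key : ∀ r, Φ r x = g • x → r = 0 ∨ γ' < |r| := by
      intro r hr
      have hr' : hΦ.orbitFlow r (orbitMk G x) = orbitMk G x := by
        rw [orbitFlow_orbitMk, hr, orbitMk_smul]
      by_contra! h
      rcases lt_or_gt_of_ne h.1 with h0 | h0
      · rw [abs_of_neg h0] at h
        refine hγ' (-r) (by linarith) h.2 ?_
        conv_lhs => rw [← hr']
        exact flow_neg_apply _ _ _
      · rw [abs_of_pos h0] at h
        exact hγ' r h0 h.2 hr'
    have hts : Φ (t - s) x = g • x := by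
      rw [sub_eq_neg_add, Flow.map_add, htx, hΦ.comm, flow_neg_apply]
    rcases key _ hts with h | h
    · rw [h, Flow.map_zero_apply] at hts
      exact hg hts.symm
    · have : |t - s| ≤ 2 * b := abs_le.2 ⟨by linarith [hs.2, ht.1], by linarith [hs.1, ht.2]⟩
      linarith
  obtain ⟨δ₀, hδ₀, hδ₀c⟩ := hK.exists_isCompact_cthickening
  obtain ⟨δ₁, hδ₁, hδ₁L⟩ := hK.exists_thickening_subset_open
    (hΦ.isOpen_longPart (by linarith : 0 ≤ γ))
    (by rintro _ ⟨t, -, x, rfl, rfl⟩; exact hΦ.flow_mem_longPart hx t)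
  have hfin := hΦ.proper _ hδ₀c
  -- Properness leaves only finitely many `g` to separate, so one `δ` serves them all.
  have hev : ∀ᶠ δ in 𝓝[>] (0 : ℝ),
      ∀ g ∈ {g : G | (Metric.cthickening δ₀ K ∩ g • Metric.cthickening δ₀ K).Nonempty},
        g • x ≠ x → Disjoint (Metric.thickening δ (g • K)) (Metric.thickening δ K) := by
    rw [Filter.eventually_all_finite hfin]
    intro g _
    by_cases hg : g • x = x
    · exact .of_forall fun _ h ↦ (h hg).elim
    have hgK : IsCompact (g • K) := hK.image (hΦ.isometry g).continuous
    obtain ⟨δ, hδ, hd⟩ := (hstab g hg).exists_thickenings hgK hK.isClosed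
    filter_upwards [Ioc_mem_nhdsGT hδ] with δ' hδ' _
    exact hd.mono (Metric.thickening_mono hδ'.2 _) (Metric.thickening_mono hδ'.2 _)
  obtain ⟨δ, hδ, ⟨hδpos, hδle⟩⟩ := (hev.and (Ioc_mem_nhdsGT (lt_min hδ₀ hδ₁))).exists
  have hsmul : ∀ g : G, g • Metric.thickening δ K ⊆ Metric.thickening δ (g • K) := by
    rintro g _ ⟨y, hy, rfl⟩
    obtain ⟨k, hk, hyk⟩ := Metric.mem_thickening_iff.1 hy
    exact Metric.mem_thickening_iff.2 ⟨g • k, smul_mem_smul_set hk,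
      ((hΦ.isometry g).dist_eq y k).trans_lt hyk⟩
  have hfix : ∀ g : G, g • x = x → g • Metric.thickening δ K = Metric.thickening δ K := by
    have hsub : ∀ g : G, g • x = x → g • Metric.thickening δ K ⊆ Metric.thickening δ K := by
      intro g hg
      refine (hsmul g).trans (Metric.thickening_subset_of_subset δ ?_)
      rintro _ ⟨_, ⟨t, ht, x, rfl, rfl⟩, rfl⟩
      change g • Φ t x ∈ K
      rw [← hΦ.comm, hg]
      exact hxK t ht
    refine fun g hg ↦ (hsub g hg).antisymm ?_
    rw [← inv_inv g, subset_smul_set_iff, inv_inv]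
    exact hsub _ (inv_smul_eq_iff.2 hg.symm)
  have hmeet : ∀ g : G, (g • Metric.thickening δ K ∩ Metric.thickening δ K).Nonempty →
      g • x = x := by
    rintro g ⟨y, hy, hyK⟩
    have hsub : Metric.thickening δ K ⊆ Metric.cthickening δ₀ K :=
      (Metric.thickening_subset_cthickening _ _).trans
        (Metric.cthickening_mono (hδle.trans (min_le_left _ _)) _)
    by_contra hg
    exact (hδ g ⟨y, hsub hyK, smul_set_mono hsub hy⟩ hg).notMem_of_mem_left (hsmul g hy) hyK
  have hKsub := Metric.self_subset_thickening hδpos K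
  refine ⟨Metric.thickening δ K, Metric.isOpen_thickening, ⟨fun g hg ↦ hfix g (hmeet g hg), ?_⟩,
    (Metric.thickening_mono (hδle.trans (min_le_right _ _)) _).trans hδ₁L,
    fun t ht ↦ hKsub (hxK t ht)⟩
  refine ((hΦ.proper {x} isCompact_singleton).subset fun g hg ↦ ?_ :
    (MulAction.stabilizer G (Metric.thickening δ K) : Set G).Finite).to_subtype
  have hg' : g • Metric.thickening δ K = Metric.thickening δ K := hg
  have : g • x = x := hmeet g ⟨x, by rw [hg']; exact hKsub hx0, hKsub hx0⟩
  exact ⟨x, rfl, x, rfl, this⟩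

end IsFlowSpace

end OrbitSpace

/-! ### Lifting covers from the orbit space, and the theorem. -/

section Lift

universe u

variable {G : Type*} {X : Type u} [Group G] [MetricSpace X] [MulAction G X] {Φ : Flow ℝ X}

/-- The distinct translates of `U` are disjoint open sets covering the connected segment, so it
stays in one of them. -/
theorem image_flow_subset_smul {𝓕 : Set (Subgroup G)} (hΦ : IsFlowSpace G Φ) {U : Set X}
    (hU : IsOpen U) (hUF : IsFamilySubset 𝓕 U) {I : Set ℝ} (hI : IsPreconnected I) {x : X}
    (hx : ∀ t ∈ I, orbitMk G (Φ t x) ∈ orbitMk G '' U) {s : ℝ} (hs : s ∈ I) {g : G}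
    (hg : Φ s x ∈ g • U) : (fun t ↦ Φ t x) '' I ⊆ g • U := by
  have := hΦ.continuousConstSMul
  have hcont : Continuous fun t ↦ Φ t x :=
    (continuous_flow Φ).comp (by fun_prop : Continuous fun t : ℝ ↦ (t, x))
  refine IsPreconnected.subset_left_of_subset_union (hU.smul g)
    (isOpen_biUnion (s := {h : G | h • U ≠ g • U}) (f := fun h ↦ h • U) fun h _ ↦ hU.smul h)
    ?_ ?_ ⟨_, ⟨s, hs, rfl⟩, hg⟩ (hI.image _ hcont.continuousOn)
  · simp only [disjoint_iUnion_right]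
    intro h hh
    rw [disjoint_iff_inter_eq_empty, ← not_nonempty_iff_eq_empty]
    exact fun hne ↦ hh (hUF.eq_of_inter hne).symm
  · rintro _ ⟨t, ht, rfl⟩
    obtain ⟨u, hu, hut⟩ := hx t ht
    obtain ⟨h, hh⟩ := orbitMk_eq_iff.1 hut.symm
    have hmem : Φ t x ∈ h • U := hh ▸ smul_mem_smul_set hu
    by_cases hhg : h • U = g • U
    · exact .inl (hhg ▸ hmem)
    · exact .inr (mem_biUnion hhg hmem)

/-- A cover of the orbit space by sets that lift to `Fin`-subsets lifts to a `Fin`-cover. -/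
theorem exists_isFamilyCoverOf_of_orbit (hΦ : IsFlowSpace G Φ) {Y : Set X}
    (hY : ∀ g : G, ∀ x ∈ Y, g • x ∈ Y) {I : Set ℝ} (hI : IsPreconnected I) (h0 : 0 ∈ I)
    {N : ℕ∞} {𝒱 : Set (Set (MulAction.orbitRel.Quotient G X))}
    (h𝒱 : ∀ V ∈ 𝒱, IsOpen V ∧ ∃ U, IsOpen U ∧ IsFamilySubset (finFamily G) U ∧ U ⊆ Y ∧
      V ⊆ orbitMk G '' U)
    (hN : ∀ x, {V ∈ 𝒱 | x ∈ V}.encard ≤ N)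
    (hcov : ∀ x ∈ Y, ∃ V ∈ 𝒱, ∀ t ∈ I, orbitMk G (Φ t x) ∈ V) :
    ∃ 𝒰 : Set (Set X), IsFamilyCoverOf (finFamily G) 𝒰 Y ∧ (∀ U ∈ 𝒰, IsOpen U) ∧
      (∀ x, {U ∈ 𝒰 | x ∈ U}.encard ≤ N) ∧ ∀ x ∈ Y, ∃ U ∈ 𝒰, (fun t ↦ Φ t x) '' I ⊆ U := by
  have := hΦ.continuousConstSMul
  choose! hVo U hUo hUF hUY hVU using h𝒱
  have hmem : ∀ x ∈ Y, ∃ V ∈ 𝒱, ∃ g : G, V.Nonempty ∧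
      (fun t ↦ Φ t x) '' I ⊆ g • U V ∩ orbitMk G ⁻¹' V := by
    intro x hx
    obtain ⟨V, hV, hVx⟩ := hcov x hx
    have hVx0 := hVx 0 h0
    obtain ⟨u, hu, hux⟩ := hVU V hV hVx0
    obtain ⟨g, hg⟩ := orbitMk_eq_iff.1 hux.symm
    refine ⟨V, hV, g, ⟨_, hVx0⟩, subset_inter ?_ ?_⟩
    · exact image_flow_subset_smul hΦ (hUo V hV) (hUF V hV) hI (fun t ht ↦ hVU V hV (hVx t ht)) h0
        (hg ▸ smul_mem_smul_set hu)
    · rintro _ ⟨t, ht, rfl⟩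
      exact hVx t ht
  have hself : ∀ x, x ∈ (fun t ↦ Φ t x) '' I := fun x ↦ ⟨0, h0, Φ.map_zero_apply x⟩
  refine ⟨{A | ∃ V ∈ 𝒱, ∃ g : G, V.Nonempty ∧ A = g • U V ∩ orbitMk G ⁻¹' V},
    ⟨⟨?_, ?_⟩, ?_⟩, ?_, ?_, ?_⟩
  · rintro h _ ⟨V, hV, g, hne, rfl⟩
    exact ⟨V, hV, h * g, hne, by rw [smul_set_inter, preimage_orbitMk_smul_set, smul_smul]⟩
  · rintro _ ⟨V, hV, g, ⟨v, hv⟩, rfl⟩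
    refine ((hUF V hV).smul_fin g).inter_fin (preimage_orbitMk_smul_set V) ?_
    obtain ⟨u, hu, rfl⟩ := hVU V hV hv
    exact ⟨g • u, smul_mem_smul_set hu, by rwa [mem_preimage, orbitMk_smul]⟩
  · refine Subset.antisymm (sUnion_subset ?_) fun x hx ↦ ?_
    · rintro _ ⟨V, hV, g, -, rfl⟩ _ ⟨⟨u, hu, rfl⟩, -⟩
      exact hY g u (hUY V hV hu)
    · obtain ⟨V, hV, g, hne, hsub⟩ := hmem x hx
      exact ⟨_, ⟨V, hV, g, hne, rfl⟩, hsub (hself x)⟩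
  · rintro _ ⟨V, hV, g, -, rfl⟩
    exact ((hUo V hV).smul g).inter ((hVo V hV).preimage hΦ.isOpenQuotientMap_orbitMk.continuous)
  · intro x
    refine le_trans ?_ (hN (orbitMk G x))
    have hch : ∀ A ∈ {A ∈ {A | ∃ V ∈ 𝒱, ∃ g : G, V.Nonempty ∧ A = g • U V ∩ orbitMk G ⁻¹' V} |
        x ∈ A}, ∃ V ∈ 𝒱, orbitMk G x ∈ V ∧ ∃ g : G, A = g • U V ∩ orbitMk G ⁻¹' V := by
      rintro _ ⟨⟨V, hV, g, -, rfl⟩, -, hxV⟩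
      exact ⟨V, hV, hxV, g, rfl⟩
    choose! V hV hxV g hg using hch
    -- For given `V`, only one translate of `U V` contains `x`, so lifting does not raise the
    -- multiplicity.
    refine encard_le_encard_of_injOn (f := V) (fun A hA ↦ ⟨hV A hA, hxV A hA⟩) ?_
    intro A hA B hB hAB
    have hxA : x ∈ g A • U (V A) := (hg A hA ▸ hA.2 : x ∈ g A • U (V A) ∩ orbitMk G ⁻¹' V A).1
    have hxB : x ∈ g B • U (V B) := (hg B hB ▸ hB.2 : x ∈ g B • U (V B) ∩ orbitMk G ⁻¹' V B).1
    rw [← hAB] at hxB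
    rw [hg A hA, hg B hB, ← hAB, (hUF _ (hV A hA)).eq_of_inter ⟨x, hxA, hxB⟩]
  · intro x hx
    obtain ⟨V, hV, g, hne, hsub⟩ := hmem x hx
    exact ⟨_, ⟨V, hV, g, hne, rfl⟩, hsub⟩

end Lift

end LongThin

theorem mainTheorem3 {G X : Type*} [Group G] [Countable G] [MetricSpace X]
    [SecondCountableTopology X] [LocallyCompactSpace X] [MulAction G X]
    (Φ : Flow ℝ X) (hΦ : LongThin.IsFlowSpace G Φ)
    (n : ℕ) (hn : smallInductiveDimension X ≤ n)
    (α : ℝ) (hα : 0 < α) :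
    ∃ 𝒰 : Set (Set X),
      LongThin.IsFamilyCoverOf (LongThin.finFamily G) 𝒰 (LongThin.longPart G Φ (20 * α)) ∧
      (∀ U ∈ 𝒰, IsOpen U) ∧
      LongThin.HasCoverDimLE 𝒰 (5 * (n + 1)) ∧
      ∀ x ∈ LongThin.longPart G Φ (20 * α),
        ∃ U ∈ 𝒰, (fun t : ℝ => Φ t x) '' Set.Icc (-α) α ⊆ U := by
  have := hΦ.metrizableSpace_orbit
  have := hΦ.secondCountableTopology_orbit
  have := hΦ.locallyCompactSpace_orbit
  obtain ⟨𝒦, h𝒦, hcpt, hdim, hcov⟩ :=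
    hΦ.exists_compact_cover_orbit (smallInductiveDimension_le_iff.1 hn)
  obtain ⟨𝒱, h𝒱, hN, h𝒱cov⟩ := LongThin.exists_long_thin_cover (Φ := hΦ.orbitFlow) (n + 1) h𝒦 hcpt
    hdim hcov hα (Y := LongThin.orbitMk G '' LongThin.longPart G Φ (20 * α))
    (by
      rintro _ ⟨x, hx, rfl⟩ t ht htα
      obtain ⟨γ', hγ, h⟩ := hΦ.exists_no_period hx
      exact h t ht (htα.trans hγ.le))
    (P := fun O ↦ ∃ U, IsOpen U ∧ LongThin.IsFamilySubset (LongThin.finFamily G) U ∧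
      U ⊆ LongThin.longPart G Φ (20 * α) ∧ O = LongThin.orbitMk G '' U)
    (by
      rintro _ ⟨x, hx, rfl⟩
      obtain ⟨U, hU, hUF, hUL, hxU⟩ := hΦ.exists_isFamilySubset_segment (b := 5 * α)
        (by positivity) (by linarith) hx
      exact ⟨_, hΦ.isOpenQuotientMap_orbitMk.isOpenMap U hU, ⟨U, hU, hUF, hUL, rfl⟩,
        fun t ht ↦ Set.mem_image_of_mem _ (hxU t ht)⟩)
  obtain ⟨𝒰, h1, h2, h3, h4⟩ := LongThin.exists_isFamilyCoverOf_of_orbit hΦ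
    (fun g x hx ↦ hΦ.smul_mem_longPart hx g) (isPreconnected_Icc (a := -α) (b := α))
    (by constructor <;> linarith)
    (fun V hV ↦ by
      obtain ⟨hVo, O, ⟨U, hU, hUF, hUL, rfl⟩, hVU⟩ := h𝒱 V hV
      exact ⟨hVo, U, hU, hUF, hUL, hVU⟩)
    hN (fun x hx ↦ h𝒱cov _ ⟨x, hx, rfl⟩)
  -- The multiplicity obtained is `5(n + 1)`, one less than dimension `5(n + 1)` allows.
  exact ⟨𝒰, h1, h2, fun x ↦ (h3 x).trans le_self_add, h4⟩
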